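/- Let $\Omega\subset\mathbb R^n$ ($n\ge 1$) be a bounded domain, $D=\Omega\times(0,1)$, and let $L_2$-spaces be real or complex. Let $\mathcal L_x$ be a self-adjoint unbounded operator in $L_2(\Omega)$ with compact resolvent satisfying $(\mathcal L_x u,u)\ge\|u\|^2$ on its domain. A number $\lambda$ is an eigenvalue of the spectral Cauchy problem $$u_{tt}(x,t)-\mathcal L_x u(x,t)=\lambda\,u(x,1-t)\quad (0<t<1),\qquad u(x,0)=u_t(x,0)=0, \tag{1}$$ if there is a function $u\not\equiv 0$ (an eigenfunction), twice continuously differentiable from $[0,1]$ to $L_2(\Omega)$ in the variable $t$, with $u(\cdot,t)\in\mathcal D(\mathcal L_x)$ for every $t\in(0,1)$, which satisfies (1). Then $\mathcal L_x$ has a complete orthonormal system of eigenfunctions $u_k$, $k\in\mathbb N$, in $L_2(\Omega)$, with eigenvalues $\mu_1\le\mu_2\le\dots$, and for every such system problem (1) has a system of eigenfunctions $$u_{km}(x,t)=u_k(x)\,v_{km}(t),\qquad k,m\in\mathbb N,$$ which is a complete orthonormal system in $L_2(D)$. Here $v_{km}\in C^2[0,1]$ are non-zero solutions of $$v_{km}''(t)-\mu_k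 v_{km}(t)=\lambda_{km}v_{km}(1-t),\quad 0<t<1,\qquad v_{km}(0)=v_{km}'(0)=0, \tag{2}$$ and the $\lambda_{km}$ are real eigenvalues of (1). Moreover, for each $k$ the numbers $\lambda_{km}$, $m\in\mathbb N$, are all the eigenvalues of problem (2) (with this $\mu_k$), and the numbers $\lambda_{km}$, $k,m\in\mathbb N$, are all the eigenvalues of (1). If the numbering is such that $\lambda_{k1}$ is, for each $k$, the eigenvalue of (2) of smallest absolute value, which is possible, then $$\lambda_{k1}=4\mu_k e^{-\sqrt{\mu_k}}\,(1+o(1))\qquad (k\to\infty).$$ -/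

import Mathlib

open MeasureTheory Set Filter Asymptotics

/-- The space `L²(Ω)` of (classes of) `𝕜`-valued functions on a set `Ω ⊆ ℝⁿ`, with Lebesgue
measure; `𝕜` is `ℝ` or `ℂ`. -/
abbrev L2Omega (𝕜 : Type) [RCLike 𝕜] {n : ℕ} (Ω : Set (EuclideanSpace ℝ (Fin n))) : Type :=
  Lp 𝕜 2 (volume.restrict Ω)

/-- The space `L²(D)` on the cylinder `D = Ω × (0,1)`, whose points are written `(x, t)`. -/
abbrev L2Cylinder (𝕜 : Type) [RCLike 𝕜] {n : ℕ} (Ω : Set (EuclideanSpace ℝ (Fin n))) : Type :=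
  Lp 𝕜 2 ((volume : Measure (EuclideanSpace ℝ (Fin n) × ℝ)).restrict (Ω ×ˢ Ioo (0 : ℝ) 1))

section operators

variable {𝕜 : Type} [RCLike 𝕜] {H : Type} [NormedAddCommGroup H] [InnerProductSpace 𝕜 H]

/-- The unbounded operator `A` has compact resolvent: for some `z` the operator `A - z`, defined
on the domain of `A`, has a two-sided inverse `R` which is everywhere defined, bounded and
compact. -/
def HasCompactResolvent (A : H →ₗ.[𝕜] H) : Prop :=
  ∃ (z : 𝕜) (R : H →L[𝕜] H), IsCompactOperator R ∧
    (∀ f : H, ∃ h : R f ∈ A.domain, A ⟨R f, h⟩ - z • R f = f) ∧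
    (∀ u : A.domain, R (A u - z • (u : H)) = u)

/-- The Friedrichs type inequality `(A u, u) ≥ ‖u‖²` on the domain of `A`. -/
def FriedrichsInequality (A : H →ₗ.[𝕜] H) : Prop :=
  ∀ u : A.domain, ‖(u : H)‖ ^ 2 ≤ RCLike.re (inner 𝕜 (A u) (u : H))

/-- `u` is a complete orthonormal system of eigenvectors of `A`, and `μ` is the corresponding
sequence of eigenvalues, each repeated according to its multiplicity and numbered in order of
size (being bounded from below and unbounded from above, they are listed increasingly). -/
structure IsEigensystem (A : H →ₗ.[𝕜] H) (μ : ℕ → ℝ) (u : HilbertBasis ℕ 𝕜 H) : Prop where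
  monotone : Monotone μ
  eigen : ∀ k, ∃ h : u k ∈ A.domain, A ⟨u k, h⟩ = (μ k : 𝕜) • u k

/-- `U`, viewed as the function `t ↦ U(·, t)` from `[0,1]` to `H`, is an eigenfunction, with
eigenvalue `z`, of the spectral Cauchy problem with deviating argument
`U_tt(t) - A U(t) = z U(1 - t)` for `0 < t < 1`, `U(0) = U_t(0) = 0`:
it is twice continuously differentiable on `[0,1]` (with one-sided derivatives at the end points),
lies in the domain of `A` for every `t ∈ (0,1)`, and does not vanish identically. -/
structure IsCauchyEigenfunction [NormedSpace ℝ H] (A : H →ₗ.[𝕜] H) (z : 𝕜) (U : ℝ → H) :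
    Prop where
  contDiffOn : ContDiffOn ℝ 2 U (Icc 0 1)
  initial : U 0 = 0
  initial_deriv : derivWithin U (Icc 0 1) 0 = 0
  equation : ∀ t ∈ Ioo (0 : ℝ) 1, ∃ h : U t ∈ A.domain,
    iteratedDerivWithin 2 U (Icc 0 1) t - A ⟨U t, h⟩ = z • U (1 - t)
  nonzero : ∃ t ∈ Icc (0 : ℝ) 1, U t ≠ 0

end operators

/-- `v` is an eigenfunction, with eigenvalue `z`, of the one-dimensional problem
`v''(t) - μ v(t) = z v(1 - t)` for `0 < t < 1`, `v(0) = v'(0) = 0`. -/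
structure IsCauchyEigenfunction1D {𝕜 : Type} [RCLike 𝕜] (μ : ℝ) (z : 𝕜) (v : ℝ → 𝕜) : Prop where
  contDiffOn : ContDiffOn ℝ 2 v (Icc 0 1)
  initial : v 0 = 0
  initial_deriv : derivWithin v (Icc 0 1) 0 = 0
  equation : ∀ t ∈ Ioo (0 : ℝ) 1,
    iteratedDerivWithin 2 v (Icc 0 1) t - (μ : 𝕜) * v t = z * v (1 - t)
  nonzero : ∃ t ∈ Icc (0 : ℝ) 1, v t ≠ 0

/-! Expanding in the eigenvectors of `A` separates the variables, so everything rests on v'' - a²v =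
λ v(1-t), v(0) = v'(0) = 0, with a = √μ_k. Without the reflection this would be a Volterra problem
with no eigenvalues. Variation of parameters gives v(t) = λ ∫₀ᵗ sinh(a(t-s))/a · v(1-s) ds, and the
substitution s ↦ 1-s turns this into v = λTv, where T has kernel κ(t+s-1) with κ(x) = sinh(a x⁺)/a.
This kernel is real and symmetric in s and t, so T is compact and symmetric on L²(0,1). It is also
injective, since every test function lies in its range. The spectral theorem yields an orthonormal
basis of eigenvectors of T; they have C² representatives solving the problem, with λ = 1/ν real, and
expansion in them excludes other eigenvalues.

For the asymptotics, κ(x) = (e^{ax} - e^{-a|x|})/(2a). The first term gives the rank one operator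
c⟨φ,·⟩φ with φ = e^{at}, c = e^{-a}/(2a), whose eigenvalue is c‖φ‖² = (e^a - e^{-a})/(4a²); the
second has norm at most 1/(2a). Hence the dominant ν is asymptotic to e^a/(4a²), and λ to 4a²e^{-a}.

In the cylinder, products of the two bases are complete by Fubini, although the second basis depends
on k. An eigenfunction U has a nonzero coefficient ⟨u_k, U(t)⟩ for some k, and this coefficient
solves the one-dimensional problem, so no new eigenvalues appear. The main carriers are
`hankel_sinhKernel`, `hankelOp_sinhKernel_injective`,
`HilbertBasis.abs_sub_le_of_rank_one_perturbation` and `exists_hilbertBasis_prod`. -/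

section Sorting

/-! ### Enumeration in increasing order. -/

/-- An infinite family of reals with finite sublevel sets can be listed in increasing order. -/
theorem exists_equiv_nat_monotone {ι : Type*} [Infinite ι] (φ : ι → ℝ)
    (hφ : ∀ c, {i | φ i ≤ c}.Finite) : ∃ e : ℕ ≃ ι, Monotone (φ ∘ e) := by
  have hcount : Countable ι := by
    rw [← Set.countable_univ_iff]
    have : (univ : Set ι) = ⋃ n : ℕ, {i | φ i ≤ n} := by
      ext i
      simpa using exists_nat_ge (φ i)
    rw [this]
    exact Set.countable_iUnion fun n => (hφ n).countable
  obtain ⟨f, hf⟩ := exists_injective_nat ι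
  -- Predecessors for the order by φ with ties broken by the injection f. Their number is an
  -- injective rank, and its infinite range in ℕ is order isomorphic to ℕ.
  let s : ι → Set ι := fun i => {j | φ j < φ i ∨ (φ j = φ i ∧ f j ≤ f i)}
  have hs : ∀ i, (s i).Finite := fun i =>
    (hφ (φ i)).subset (by rintro j (h | h); exacts [h.le, h.1.le])
  have hself : ∀ i, i ∈ s i := fun i => Or.inr ⟨rfl, le_rfl⟩
  have hlt : ∀ i j, (φ i < φ j ∨ (φ i = φ j ∧ f i < f j)) → (s i).ncard < (s j).ncard := by
    intro i j hij
    refine Set.ncard_lt_ncard ⟨?_, fun h => ?_⟩ (hs j)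
    · rintro l (hl | ⟨hl, hl'⟩) <;> rcases hij with h | ⟨h, h'⟩
      · exact Or.inl (hl.trans h)
      · exact Or.inl (hl.trans_eq h)
      · exact Or.inl (hl ▸ h)
      · exact Or.inr ⟨hl.trans h, hl'.trans h'.le⟩
    · rcases h (hself j) with h | ⟨h, h'⟩ <;> rcases hij with h1 | ⟨h1, h2⟩
      · exact lt_asymm h h1
      · exact h.ne h1.symm
      · exact h1.ne h.symm
      · omega
  have hle : ∀ i j, (s i).ncard ≤ (s j).ncard → φ i ≤ φ j := by
    intro i j h
    by_contra! h'
    exact absurd (hlt j i (Or.inl h')) (not_lt.2 h)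
  have hinj : Function.Injective fun i => (s i).ncard := by
    intro i j hij
    have h1 : φ i = φ j := le_antisymm (hle i j hij.le) (hle j i hij.ge)
    rcases lt_trichotomy (f i) (f j) with h | h | h
    · exact absurd hij (hlt i j (Or.inr ⟨h1, h⟩)).ne
    · exact hf h
    · exact absurd hij (hlt j i (Or.inr ⟨h1.symm, h⟩)).ne'
  let r := range fun i => (s i).ncard
  have : Infinite r := (Set.infinite_range_of_injective hinj).to_subtype
  classical
  let e₁ : ι ≃ r := Equiv.ofInjective _ hinj
  let e₂ : ℕ ≃o r := Nat.Subtype.orderIsoOfNat r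
  refine ⟨e₂.toEquiv.trans e₁.symm, fun m n hmn => hle _ _ ?_⟩
  have key : ∀ x : r, (s (e₁.symm x)).ncard = x := fun x =>
    congrArg Subtype.val (e₁.apply_symm_apply x)
  simp only [Equiv.trans_apply, key]
  exact e₂.monotone hmn

end Sorting

/-! ### Compact symmetric operators. -/

section Spectral

variable {𝕜 : Type*} [RCLike 𝕜] {H : Type*} [NormedAddCommGroup H] [InnerProductSpace 𝕜 H]

/-- The eigenvalues of a compact operator along an orthonormal family do not accumulate away
from zero. -/
theorem IsCompactOperator.finite_setOf_le_abs_eigenvalue {S : H →L[𝕜] H}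
    (hS : IsCompactOperator S) {ι : Type*} {e : ι → H} (he : Orthonormal 𝕜 e) {ν : ι → ℝ}
    (hν : ∀ i, S (e i) = (ν i : 𝕜) • e i) {ε : ℝ} (hε : 0 < ε) : {i | ε ≤ |ν i|}.Finite := by
  by_contra hinf
  let f := Set.Infinite.natEmbedding _ hinf
  let g : ℕ → H := fun n => S (e (f n))
  obtain ⟨K, hK, hSK⟩ := hS.image_closedBall_subset_compact 1
  obtain ⟨x, -, ψ, hψ, hlim⟩ := hK.tendsto_subseq (x := g) fun n =>
    hSK ⟨e (f n), by simp [he.1], rfl⟩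
  obtain ⟨N, hN⟩ := Metric.cauchySeq_iff.1 hlim.cauchySeq ε hε
  have h1 := hN N le_rfl (N + 1) N.le_succ
  have hne : (f (ψ N) : ι) ≠ f (ψ (N + 1)) := fun h =>
    (hψ N.lt_succ_self).ne (f.injective (Subtype.ext h))
  have horth : inner 𝕜 (g (ψ N)) (g (ψ (N + 1))) = 0 := by
    simp only [g, hν, inner_smul_left, inner_smul_right, he.2 hne, mul_zero]
  -- By Pythagoras, two orthogonal images of norm at least ε are at distance at least ε, so no
  -- subsequence is Cauchy.
  have h2 : ‖g (ψ N) - g (ψ (N + 1))‖ * ‖g (ψ N) - g (ψ (N + 1))‖ =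
      ‖g (ψ N)‖ * ‖g (ψ N)‖ + ‖g (ψ (N + 1))‖ * ‖g (ψ (N + 1))‖ := by
    rw [@norm_sub_mul_self 𝕜, horth]; simp
  have h3 : ε ≤ ‖g (ψ N)‖ := by
    simp only [g, hν, norm_smul, he.1, mul_one, RCLike.norm_ofReal]
    exact (f (ψ N)).2
  simp only [Function.comp, dist_eq_norm] at h1
  nlinarith [norm_nonneg (g (ψ N) - g (ψ (N + 1))), norm_nonneg (g (ψ (N + 1)))]

/-- An orthonormal basis of eigenvectors of an injective compact symmetric operator. -/
theorem IsCompactOperator.exists_hilbertBasis_eigenvectors [CompleteSpace H] {S : H →L[𝕜] H}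
    (hS : IsCompactOperator S) (hsymm : (S : H →ₗ[𝕜] H).IsSymmetric)
    (hinj : ∀ x, S x = 0 → x = 0) (hdim : ¬ FiniteDimensional 𝕜 H) :
    ∃ (b : HilbertBasis ℕ 𝕜 H) (ν : ℕ → ℝ), (∀ i, S (b i) = (ν i : 𝕜) • b i) ∧
      (∀ i, ν i ≠ 0) ∧ Antitone fun i => |ν i| := by
  -- Compactness bounds the dimension only for z ≠ 0; injectivity disposes of z = 0.
  have hfd : ∀ z : 𝕜, FiniteDimensional 𝕜 (Module.End.eigenspace (S : H →ₗ[𝕜] H) z) := by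
    intro z
    rcases eq_or_ne z 0 with rfl | hz
    · have : Module.End.eigenspace (S : H →ₗ[𝕜] H) 0 = ⊥ := by
        rw [eq_bot_iff]
        intro x hx
        rw [Module.End.mem_eigenspace_iff, zero_smul] at hx
        exact hinj x hx
      rw [this]
      infer_instance
    · exact ContinuousLinearMap.finite_dimensional_eigenspace hS z hz
  -- All scalars are allowed: those that are not eigenvalues contribute an empty fibre.
  let ι := Σ z : 𝕜, Fin (Module.finrank 𝕜 (Module.End.eigenspace (S : H →ₗ[𝕜] H) z))
  let e : ι → H := fun a =>
    (stdOrthonormalBasis 𝕜 (Module.End.eigenspace (S : H →ₗ[𝕜] H) a.1) a.2 : H)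
  have he : Orthonormal 𝕜 e :=
    hsymm.orthogonalFamily_eigenspaces.orthonormal_sigma_orthonormal
      (v_family := fun z i => stdOrthonormalBasis 𝕜 (Module.End.eigenspace (S : H →ₗ[𝕜] H) z) i)
      fun z => (stdOrthonormalBasis 𝕜 _).orthonormal
  have hperp : (Submodule.span 𝕜 (range e))ᗮ = ⊥ := by
    rw [eq_bot_iff, ← ContinuousLinearMap.orthogonalComplement_iSup_eigenspaces_eq_bot hS hsymm]
    refine Submodule.orthogonal_le (iSup_le fun z x hx => ?_)
    have h1 := (stdOrthonormalBasis 𝕜 (Module.End.eigenspace (S : H →ₗ[𝕜] H) z)).sum_repr ⟨x, hx⟩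
    have h2 := congrArg Subtype.val h1
    simp only [AddSubmonoidClass.coe_finsetSum, Submodule.coe_smul] at h2
    rw [← h2]
    exact Submodule.sum_mem _ fun i _ => Submodule.smul_mem _ _
      (Submodule.subset_span ⟨⟨z, i⟩, rfl⟩)
  have hmem : ∀ a : ι, S (e a) = a.1 • e a := fun a =>
    Module.End.mem_eigenspace_iff.1 (Subtype.prop _)
  have hne : ∀ a, e a ≠ 0 := he.ne_zero
  have hreal : ∀ a : ι, ((RCLike.re a.1 : ℝ) : 𝕜) = a.1 := by
    intro a
    refine RCLike.conj_eq_iff_re.1 (hsymm.conj_eigenvalue_eq_self ?_)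
    exact Module.End.hasEigenvalue_of_hasEigenvector
      ⟨Module.End.mem_eigenspace_iff.2 (hmem a), hne a⟩
  have hmem' : ∀ a : ι, S (e a) = ((RCLike.re a.1 : ℝ) : 𝕜) • e a := fun a => by
    rw [hreal, hmem]
  have hnz : ∀ a : ι, RCLike.re a.1 ≠ 0 := by
    intro a h
    apply hne a
    apply hinj
    rw [hmem', h]
    simp
  have hinfι : Infinite ι := by
    by_contra hfin
    rw [not_infinite_iff_finite] at hfin
    have := Fintype.ofFinite ι
    let b := (HilbertBasis.mkOfOrthogonalEqBot he hperp).toOrthonormalBasis.toBasis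
    exact hdim b.finiteDimensional_of_finite
  obtain ⟨σ, hσ⟩ := exists_equiv_nat_monotone (fun a : ι => |RCLike.re a.1|⁻¹) (by
    intro c
    -- The maximum with 1 keeps the threshold positive for every c.
    refine (hS.finite_setOf_le_abs_eigenvalue he hmem' (ε := (max c 1)⁻¹) (by positivity)).subset ?_
    intro a ha
    exact inv_le_of_inv_le₀ (abs_pos.2 (hnz a)) (le_max_of_le_left ha))
  have he' : Orthonormal 𝕜 (e ∘ σ) := he.comp σ σ.injective
  have hperp' : (Submodule.span 𝕜 (range (e ∘ σ)))ᗮ = ⊥ := by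
    rw [σ.surjective.range_comp, hperp]
  refine ⟨HilbertBasis.mkOfOrthogonalEqBot he' hperp', fun i => RCLike.re (σ i).1, ?_, ?_, ?_⟩
  · intro i
    simp only [HilbertBasis.coe_mkOfOrthogonalEqBot, Function.comp]
    exact hmem' _
  · exact fun i => hnz _
  · exact fun i j hij => (inv_le_inv₀ (abs_pos.2 (hnz _)) (abs_pos.2 (hnz _))).1 (hσ hij)

end Spectral

/-! ### The operator A: compact inverse and eigensystem. -/

section SelfAdjoint

variable {𝕜 : Type} [RCLike 𝕜] {H : Type} [NormedAddCommGroup H] [InnerProductSpace 𝕜 H]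

theorem FriedrichsInequality.eq_zero {A : H →ₗ.[𝕜] H} (hA : FriedrichsInequality A)
    (u : A.domain) (h : A u = 0) : (u : H) = 0 := by
  have := hA u
  rw [h, inner_zero_left, map_zero] at this
  exact norm_eq_zero.1 (pow_eq_zero_iff two_ne_zero |>.1 (le_antisymm this (by positivity)))

theorem FriedrichsInequality.one_le_of_eigenvector {A : H →ₗ.[𝕜] H} (hA : FriedrichsInequality A)
    {x : H} (hx : x ∈ A.domain) (hx1 : ‖x‖ = 1) {c : ℝ} (h : A ⟨x, hx⟩ = (c : 𝕜) • x) :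
    1 ≤ c := by
  have h3 := hA ⟨x, hx⟩
  rw [h, inner_smul_left, inner_self_eq_norm_sq_to_K] at h3
  simpa [hx1] using h3

theorem LinearPMap.inner_apply_eq_of_isSelfAdjoint [CompleteSpace H] {A : H →ₗ.[𝕜] H}
    (hA : IsSelfAdjoint A) (u v : A.domain) : inner 𝕜 (A u) (v : H) = inner 𝕜 (u : H) (A v) := by
  have h := LinearPMap.adjoint_isFormalAdjoint hA.dense_domain
  rw [LinearPMap.isSelfAdjoint_def.1 hA] at h
  exact h u v

/-- A positive definite operator with compact resolvent has a compact inverse. -/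
theorem HasCompactResolvent.exists_compact_inverse [CompleteSpace H] {A : H →ₗ.[𝕜] H}
    (hcpt : HasCompactResolvent A) (hpos : FriedrichsInequality A) :
    ∃ S : H →L[𝕜] H, IsCompactOperator S ∧
      (∀ f, ∃ h : S f ∈ A.domain, A ⟨S f, h⟩ = f) ∧ ∀ u : A.domain, S (A u) = u := by
  obtain ⟨z, R, hR, hR1, -⟩ := hcpt
  suffices h : ∃ S : H →L[𝕜] H, IsCompactOperator S ∧
      (∀ f, ∃ h : S f ∈ A.domain, A ⟨S f, h⟩ = f) by
    obtain ⟨S, h1, h2⟩ := h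
    refine ⟨S, h1, h2, fun u => ?_⟩
    obtain ⟨h3, h4⟩ := h2 (A u)
    have := hpos.eq_zero (⟨S (A u), h3⟩ - u) (by rw [LinearPMap.map_sub, h4, sub_self])
    exact sub_eq_zero.1 this
  rcases eq_or_ne z 0 with rfl | hz
  · exact ⟨R, hR, fun f => by simpa using hR1 f⟩
  -- Fredholm alternative: if x = -zRx, then A(Rx) = x + zRx = 0, so Rx = 0 by positivity and x = 0.
  -- The inverse of A is then (1 + zR)⁻¹R.
  have hunit : IsUnit (1 + z • R) := by
    have hz' : -z⁻¹ ≠ 0 := neg_ne_zero.2 (inv_ne_zero hz)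
    rcases hR.hasEigenvalue_or_mem_resolventSet hz' with h | h
    · obtain ⟨x, hx, hx0⟩ := h.exists_hasEigenvector
      rw [Module.End.mem_eigenspace_iff] at hx
      change R x = -z⁻¹ • x at hx
      obtain ⟨h1, h2⟩ := hR1 x
      have h3 : x = -(z • R x) := by
        rw [hx, smul_smul, mul_neg, mul_inv_cancel₀ hz, neg_smul, one_smul, neg_neg]
      have h4 : A ⟨R x, h1⟩ = 0 := by
        rw [sub_eq_iff_eq_add] at h2
        rw [h2]
        nth_rw 1 [h3]
        simp
      have h5 : R x = 0 := hpos.eq_zero _ h4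
      rw [h5] at h3
      simp at h3
      exact absurd h3 hx0
    · rw [spectrum.mem_resolventSet_iff] at h
      have h6 : (1 + z • R) =
          algebraMap 𝕜 (H →L[𝕜] H) (-z) * (algebraMap 𝕜 (H →L[𝕜] H) (-z⁻¹) - R) := by
        ext x
        simp [Algebra.algebraMap_eq_smul_one, smul_sub, smul_smul, hz, add_comm]
      rw [h6]
      exact ((IsUnit.mk0 _ (neg_ne_zero.2 hz)).map _).mul h
  obtain ⟨B, hB⟩ := hunit
  refine ⟨(↑B⁻¹ : H →L[𝕜] H) ∘L R, hR.clm_comp _, fun f => ?_⟩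
  set x := ((↑B⁻¹ : H →L[𝕜] H) ∘L R) f with hx
  have h1 : x + z • R x = R f := by
    have : (B * ↑B⁻¹ : H →L[𝕜] H) (R f) = R f := by rw [B.mul_inv]; rfl
    rw [hB] at this
    simpa [hx] using this
  have h2 : x = R (f - z • x) := by
    rw [map_sub, map_smul, ← h1, add_sub_cancel_right]
  obtain ⟨h3, h4⟩ := hR1 (f - z • x)
  refine ⟨h2 ▸ h3, ?_⟩
  have h5 : (⟨x, h2 ▸ h3⟩ : A.domain) = ⟨R (f - z • x), h3⟩ := Subtype.ext h2
  rw [h5, sub_eq_iff_eq_add.1 h4, ← h2, sub_add_cancel]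

/-- A self-adjoint positive definite operator with compact resolvent has an eigensystem. -/
theorem exists_isEigensystem [CompleteSpace H] {A : H →ₗ.[𝕜] H} (hA : IsSelfAdjoint A)
    (hcpt : HasCompactResolvent A) (hpos : FriedrichsInequality A)
    (hdim : ¬ FiniteDimensional 𝕜 H) :
    ∃ (μ : ℕ → ℝ) (u : HilbertBasis ℕ 𝕜 H), IsEigensystem A μ u := by
  obtain ⟨S, hS, hS1, hS2⟩ := hcpt.exists_compact_inverse hpos
  have hsymm : (S : H →ₗ[𝕜] H).IsSymmetric := by
    intro f g
    obtain ⟨h1, h2⟩ := hS1 f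
    obtain ⟨h3, h4⟩ := hS1 g
    have := LinearPMap.inner_apply_eq_of_isSelfAdjoint hA ⟨S f, h1⟩ ⟨S g, h3⟩
    rw [h2, h4] at this
    exact this.symm
  have hinj : ∀ x, S x = 0 → x = 0 := by
    intro x hx
    obtain ⟨h1, h2⟩ := hS1 x
    have : (⟨S x, h1⟩ : A.domain) = 0 := Subtype.ext hx
    rw [← h2, this, LinearPMap.map_zero]
  obtain ⟨b, ν, hb, hν, hanti⟩ := hS.exists_hilbertBasis_eigenvectors hsymm hinj hdim
  have key : ∀ i, ∃ h : b i ∈ A.domain, A ⟨b i, h⟩ = (((ν i)⁻¹ : ℝ) : 𝕜) • b i := by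
    intro i
    obtain ⟨h1, h2⟩ := hS1 ((((ν i)⁻¹ : ℝ) : 𝕜) • b i)
    have h3 : S ((((ν i)⁻¹ : ℝ) : 𝕜) • b i) = b i := by
      rw [map_smul, hb, smul_smul, ← RCLike.ofReal_mul, inv_mul_cancel₀ (hν i)]
      simp
    refine ⟨h3 ▸ h1, ?_⟩
    exact (congrArg (fun y : A.domain => A y) (Subtype.ext h3.symm)).trans h2
  have hge : ∀ i, 1 ≤ (ν i)⁻¹ := by
    intro i
    obtain ⟨h1, h2⟩ := key i
    exact hpos.one_le_of_eigenvector h1 (b.orthonormal.1 i) h2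
  refine ⟨fun i => (ν i)⁻¹, b, ⟨fun i j hij => ?_, key⟩⟩
  have hpos : ∀ i, 0 < ν i := fun i => inv_pos.1 (one_pos.trans_le (hge i))
  have := hanti hij
  simp only [abs_of_pos (hpos _)] at this
  exact inv_anti₀ (hpos j) this

theorem IsEigensystem.one_le {A : H →ₗ.[𝕜] H} {μ : ℕ → ℝ} {u : HilbertBasis ℕ 𝕜 H}
    (h : IsEigensystem A μ u) (hpos : FriedrichsInequality A) (k : ℕ) : 1 ≤ μ k := by
  obtain ⟨h1, h2⟩ := h.eigen k
  exact hpos.one_le_of_eigenvector h1 (u.orthonormal.1 k) h2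

/-- The compact inverse has eigenvalues 1/μ_k on the u_k. If μ were bounded, infinitely many of them
would stay away from zero. -/
theorem IsEigensystem.tendsto_atTop [CompleteSpace H] {A : H →ₗ.[𝕜] H} {μ : ℕ → ℝ}
    {u : HilbertBasis ℕ 𝕜 H} (h : IsEigensystem A μ u) (hcpt : HasCompactResolvent A)
    (hpos : FriedrichsInequality A) : Tendsto μ atTop atTop := by
  obtain ⟨S, hS, hS1, hS2⟩ := hcpt.exists_compact_inverse hpos
  have hSu : ∀ k, S (u k) = (((μ k)⁻¹ : ℝ) : 𝕜) • u k := by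
    intro k
    have hμ : μ k ≠ 0 := by linarith [h.one_le hpos k]
    obtain ⟨h1, h2⟩ := h.eigen k
    have h3 := hS2 ⟨u k, h1⟩
    rw [h2, map_smul] at h3
    change (μ k : 𝕜) • S (u k) = u k at h3
    rw [← h3, smul_smul, ← RCLike.ofReal_mul, inv_mul_cancel₀ hμ, h3]
    simp
  refine tendsto_atTop_atTop_of_monotone h.monotone fun c => ?_
  by_contra! hc
  have hfin := hS.finite_setOf_le_abs_eigenvalue u.orthonormal hSu (ε := (max c 1)⁻¹)
    (by positivity)
  refine Set.infinite_univ (hfin.subset fun k _ => ?_)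
  have h0 : 0 < μ k := by linarith [h.one_le hpos k]
  change _ ≤ |(μ k)⁻¹|
  rw [abs_of_pos (inv_pos.2 h0)]
  exact inv_anti₀ h0 ((hc k).le.trans (le_max_left _ _))

end SelfAdjoint

/-! ### Infinite dimension of L². -/

section InfiniteDimensional

/-- The space `L²` of an infinite open set of finite measure is infinite-dimensional. -/
theorem not_finiteDimensional_Lp_restrict (𝕜 : Type*) [RCLike 𝕜] {X : Type*} [TopologicalSpace X]
    [T2Space X] [MeasurableSpace X] [OpensMeasurableSpace X] (ρ : Measure X)
    [ρ.IsOpenPosMeasure] {s : Set X} (hs : IsOpen s) (hinf : s.Infinite) (hfin : ρ s ≠ ⊤) :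
    ¬ FiniteDimensional 𝕜 (Lp 𝕜 2 (ρ.restrict s)) := by
  have := hinf.to_subtype
  -- Disjoint nonempty open sets have nonzero, pairwise orthogonal indicators.
  obtain ⟨U, hUinf, hUo, hUd⟩ := exists_seq_infinite_isOpen_pairwise_disjoint s
  let V : ℕ → Set X := fun n => Subtype.val '' U n
  have hVo : ∀ n, IsOpen (V n) := fun n => hs.isOpenMap_subtype_val _ (hUo n)
  have hVs : ∀ n, V n ⊆ s := fun n => by rintro _ ⟨x, -, rfl⟩; exact x.2
  have hVd : ∀ m n, m ≠ n → V m ∩ V n = ∅ := fun m n hmn => by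
    rw [← Set.disjoint_iff_inter_eq_empty]
    exact (Set.disjoint_image_iff Subtype.val_injective).2 (hUd hmn)
  have hr : ∀ n, ρ.restrict s (V n) = ρ (V n) := fun n => by
    rw [Measure.restrict_apply (hVo n).measurableSet, inter_eq_left.2 (hVs n)]
  have hne : ∀ n, ρ.restrict s (V n) ≠ ⊤ := fun n => by
    rw [hr]
    exact measure_ne_top_of_subset (hVs n) hfin
  have hpos : ∀ n, ρ.restrict s (V n) ≠ 0 := fun n => by
    rw [hr]
    exact (hVo n).measure_ne_zero ρ ((hUinf n).nonempty.image _)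
  let e : ℕ → Lp 𝕜 2 (ρ.restrict s) := fun n =>
    indicatorConstLp 2 (hVo n).measurableSet (hne n) (1 : 𝕜)
  have hli : LinearIndependent 𝕜 e := by
    refine linearIndependent_of_ne_zero_of_inner_eq_zero (fun n h => ?_) fun m n hmn => ?_
    · have h1 := congrArg norm h
      rw [norm_indicatorConstLp two_ne_zero ENNReal.ofNat_ne_top, norm_zero, norm_one,
        one_mul] at h1
      have h2 : 0 < (ρ.restrict s).real (V n) := ENNReal.toReal_pos (hpos n) (hne n)
      exact (Real.rpow_pos_of_pos h2 _).ne' h1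
    · simp only [e]
      rw [L2.inner_indicatorConstLp_one]
      rw [setIntegral_congr_ae (g := fun _ => (0:𝕜)) (hVo m).measurableSet]
      · simp
      · filter_upwards [indicatorConstLp_coeFn (p := 2) (hs := (hVo n).measurableSet)
          (hμs := hne n) (c := (1:𝕜))]
          with x hx hxm
        rw [hx, Set.indicator_of_notMem]
        intro hxn
        have : x ∈ V m ∩ V n := ⟨hxm, hxn⟩
        rw [hVd m n hmn] at this
        exact this
  intro hfd
  exact Set.infinite_univ (Set.finite_univ_iff.2 hli.finite_of_isNoetherian)

end InfiniteDimensional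

/-! ### Integral operators on (0,1) with kernel κ(t+s-1). -/

section Hankel

/-- Lebesgue measure on the unit interval. -/
noncomputable abbrev unitMeasure : Measure ℝ := volume.restrict (Ioo (0 : ℝ) 1)

instance : IsProbabilityMeasure unitMeasure := ⟨by simp [unitMeasure]⟩

variable {𝕜 : Type*} [RCLike 𝕜]

theorem ae_unitMeasure_mem : ∀ᵐ t ∂unitMeasure, t ∈ Ioo (0 : ℝ) 1 :=
  ae_restrict_mem measurableSet_Ioo

theorem integrable_unitMeasure_Lp (f : Lp 𝕜 2 unitMeasure) : Integrable f unitMeasure :=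
  (Lp.memLp f).integrable one_le_two

theorem integral_norm_le_norm_Lp (f : Lp 𝕜 2 unitMeasure) : ∫ t, ‖f t‖ ∂unitMeasure ≤ ‖f‖ := by
  rw [integral_norm_eq_lintegral_enorm (Lp.aestronglyMeasurable f),
    ← eLpNorm_one_eq_lintegral_enorm,
    Lp.norm_def]
  exact ENNReal.toReal_mono (Lp.eLpNorm_ne_top f)
    (eLpNorm_le_eLpNorm_of_exponent_le one_le_two (Lp.aestronglyMeasurable f))

theorem norm_Lp_le_of_ae_bound_unitMeasure {f : Lp 𝕜 2 unitMeasure} {C : ℝ} (hC : 0 ≤ C)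
    (h : ∀ᵐ t ∂unitMeasure, ‖f t‖ ≤ C) : ‖f‖ ≤ C := by
  have := Lp.norm_le_of_ae_bound hC h
  simpa [measureUnivNNReal] using this

/-- The integral operator on the unit interval with kernel `κ (t + s - 1)`. -/
noncomputable def hankel (κ : ℝ → ℝ) (f : ℝ → 𝕜) (t : ℝ) : 𝕜 :=
  ∫ s, (κ (t + s - 1) : 𝕜) * f s ∂unitMeasure

theorem exists_abs_le_of_continuous (κ : C(ℝ, ℝ)) (a b : ℝ) :
    ∃ C, 0 ≤ C ∧ ∀ x ∈ Icc a b, |κ x| ≤ C := by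
  obtain ⟨C, hC⟩ := isCompact_Icc.exists_bound_of_continuousOn (s := Icc a b)
    κ.continuous.continuousOn
  exact ⟨max C 0, le_max_right _ _, fun x hx => (hC x hx).trans (le_max_left _ _)⟩

theorem aestronglyMeasurable_hankel_integrand (κ : C(ℝ, ℝ)) {f : ℝ → 𝕜}
    (hf : Integrable f unitMeasure) (t : ℝ) :
    AEStronglyMeasurable (fun s => (κ (t + s - 1) : 𝕜) * f s) unitMeasure :=
  (RCLike.continuous_ofReal.comp (κ.continuous.comp
    (by fun_prop : Continuous fun s : ℝ => t + s - 1))).aestronglyMeasurable.mul hf.1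

theorem integrable_hankel_integrand (κ : C(ℝ, ℝ)) {f : ℝ → 𝕜}
    (hf : Integrable f unitMeasure) (t : ℝ) :
    Integrable (fun s => (κ (t + s - 1) : 𝕜) * f s) unitMeasure := by
  obtain ⟨C, hC0, hC⟩ := exists_abs_le_of_continuous κ (t - 1) t
  refine (hf.norm.const_mul C).mono' (aestronglyMeasurable_hankel_integrand κ hf t) ?_
  filter_upwards [ae_unitMeasure_mem] with s hs
  rw [norm_mul, RCLike.norm_ofReal]
  exact mul_le_mul_of_nonneg_right (hC _ ⟨by linarith [hs.1], by linarith [hs.2]⟩) (norm_nonneg _)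

theorem continuous_hankel (κ : C(ℝ, ℝ)) {f : ℝ → 𝕜} (hf : Integrable f unitMeasure) :
    Continuous (hankel κ f) := by
  refine continuous_iff_continuousAt.2 fun t₀ => ?_
  obtain ⟨C, hC0, hC⟩ := exists_abs_le_of_continuous κ (t₀ - 2) (t₀ + 1)
  refine continuousAt_of_dominated (bound := fun s => C * ‖f s‖)
    (Eventually.of_forall fun t => aestronglyMeasurable_hankel_integrand κ hf t) ?_
    (hf.norm.const_mul C) (Eventually.of_forall fun s => ?_)
  · filter_upwards [Icc_mem_nhds (sub_one_lt t₀) (lt_add_one t₀)] with t ht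
    filter_upwards [ae_unitMeasure_mem] with s hs
    rw [norm_mul, RCLike.norm_ofReal]
    exact mul_le_mul_of_nonneg_right
      (hC _ ⟨by linarith [hs.1, ht.1], by linarith [hs.2, ht.2]⟩) (norm_nonneg _)
  · have : Continuous fun t : ℝ => (κ (t + s - 1) : 𝕜) * f s := by fun_prop
    exact this.continuousAt

theorem norm_hankel_le {κ : C(ℝ, ℝ)} {C : ℝ} (hC : ∀ x ∈ Icc (-1 : ℝ) 1, |κ x| ≤ C)
    (f : Lp 𝕜 2 unitMeasure) {t : ℝ} (ht : t ∈ Ioo (0 : ℝ) 1) : ‖hankel κ f t‖ ≤ C * ‖f‖ := by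
  have hf := integrable_unitMeasure_Lp f
  have hC0 : 0 ≤ C := (abs_nonneg _).trans (hC 0 (by norm_num))
  calc ‖hankel κ f t‖ ≤ ∫ s, C * ‖f s‖ ∂unitMeasure := by
        refine norm_integral_le_of_norm_le (hf.norm.const_mul C) ?_
        filter_upwards [ae_unitMeasure_mem] with s hs
        rw [norm_mul, RCLike.norm_ofReal]
        exact mul_le_mul_of_nonneg_right
          (hC _ ⟨by linarith [hs.1, ht.1], by linarith [hs.2, ht.2]⟩) (norm_nonneg _)
    _ ≤ C * ‖f‖ := by
        rw [integral_const_mul]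
        exact mul_le_mul_of_nonneg_left (integral_norm_le_norm_Lp f) hC0

theorem memLp_unitMeasure_of_continuous {g : ℝ → 𝕜} (hg : Continuous g) :
    MemLp g 2 unitMeasure := by
  obtain ⟨C, hC⟩ := isCompact_Icc.exists_bound_of_continuousOn (s := Icc (0 : ℝ) 1) hg.continuousOn
  refine MemLp.of_bound hg.aestronglyMeasurable C ?_
  filter_upwards [ae_unitMeasure_mem] with t ht using hC t (Ioo_subset_Icc_self ht)

theorem hankel_congr_ae (κ : ℝ → ℝ) {f g : ℝ → 𝕜} (h : f =ᵐ[unitMeasure] g) (t : ℝ) :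
    hankel κ f t = hankel κ g t :=
  integral_congr_ae (h.mono fun s hs => by simp only [hs])

variable (𝕜) in
/-- The integral operator on `L²(0,1)` with kernel `κ (t + s - 1)`. -/
noncomputable def hankelOp (κ : C(ℝ, ℝ)) : Lp 𝕜 2 unitMeasure →L[𝕜] Lp 𝕜 2 unitMeasure :=
  LinearMap.mkContinuousOfExistsBound
    { toFun := fun f => (memLp_unitMeasure_of_continuous
        (continuous_hankel κ (integrable_unitMeasure_Lp f))).toLp _
      map_add' := fun f g => by
        rw [← MemLp.toLp_add]
        congr 1
        funext t
        simp only [hankel, Pi.add_apply]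
        rw [← integral_add (integrable_hankel_integrand κ (integrable_unitMeasure_Lp f) t)
          (integrable_hankel_integrand κ (integrable_unitMeasure_Lp g) t)]
        refine integral_congr_ae ((Lp.coeFn_add f g).mono fun s hs => ?_)
        simp only [hs, Pi.add_apply, mul_add]
      map_smul' := fun c f => by
        rw [RingHom.id_apply, ← MemLp.toLp_const_smul]
        congr 1
        funext t
        simp only [hankel, Pi.smul_apply, smul_eq_mul]
        rw [← integral_const_mul]
        refine integral_congr_ae ((Lp.coeFn_smul c f).mono fun s hs => ?_)
        simp only [hs, Pi.smul_apply, smul_eq_mul]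
        ring }
    (by
      obtain ⟨C, hC0, hC⟩ := exists_abs_le_of_continuous κ (-1) 1
      refine ⟨C, fun f => norm_Lp_le_of_ae_bound_unitMeasure (by positivity) ?_⟩
      filter_upwards [ae_unitMeasure_mem, MemLp.coeFn_toLp (memLp_unitMeasure_of_continuous
        (continuous_hankel κ (integrable_unitMeasure_Lp f)))] with t ht ht'
      exact (congrArg norm ht').trans_le (norm_hankel_le hC f ht))

theorem coeFn_hankelOp (κ : C(ℝ, ℝ)) (f : Lp 𝕜 2 unitMeasure) :
    hankelOp 𝕜 κ f =ᵐ[unitMeasure] hankel κ f :=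
  MemLp.coeFn_toLp (memLp_unitMeasure_of_continuous
    (continuous_hankel κ (integrable_unitMeasure_Lp f)))

/-- The interval has mass 1, so the sup norm of the image is at most C times the L¹ norm, which the
L² norm dominates. Only [-1,1] matters, as t+s-1 stays there. -/
theorem norm_hankelOp_le {κ : C(ℝ, ℝ)} {C : ℝ} (hC : ∀ x ∈ Icc (-1 : ℝ) 1, |κ x| ≤ C) :
    ‖hankelOp 𝕜 κ‖ ≤ C := by
  have hC0 : 0 ≤ C := (abs_nonneg _).trans (hC 0 (by norm_num))
  refine ContinuousLinearMap.opNorm_le_bound _ hC0 fun f =>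
    norm_Lp_le_of_ae_bound_unitMeasure (by positivity) ?_
  filter_upwards [ae_unitMeasure_mem, coeFn_hankelOp κ f] with t ht ht'
  rw [ht']
  exact norm_hankel_le hC f ht

theorem hankelOp_add (κ₁ κ₂ : C(ℝ, ℝ)) :
    hankelOp 𝕜 (κ₁ + κ₂) = hankelOp 𝕜 κ₁ + hankelOp 𝕜 κ₂ := by
  ext1 f
  refine Lp.ext ?_
  rw [add_apply]
  filter_upwards [coeFn_hankelOp (κ₁ + κ₂) f, coeFn_hankelOp κ₁ f, coeFn_hankelOp κ₂ f,
    Lp.coeFn_add (hankelOp 𝕜 κ₁ f) (hankelOp 𝕜 κ₂ f)] with t h h1 h2 h3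
  rw [h, h3, Pi.add_apply, h1, h2]
  simp only [hankel]
  rw [← integral_add (integrable_hankel_integrand κ₁ (integrable_unitMeasure_Lp f) t)
          (integrable_hankel_integrand κ₂ (integrable_unitMeasure_Lp f) t)]
  simp [add_mul]

theorem hankelOp_sub (κ₁ κ₂ : C(ℝ, ℝ)) :
    hankelOp 𝕜 (κ₁ - κ₂) = hankelOp 𝕜 κ₁ - hankelOp 𝕜 κ₂ := by
  rw [eq_sub_iff_add_eq, ← hankelOp_add, sub_add_cancel]

theorem inner_Lp_eq_integral {f g : Lp 𝕜 2 unitMeasure} {f' g' : ℝ → 𝕜} (hf : f =ᵐ[unitMeasure] f')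
    (hg : g =ᵐ[unitMeasure] g') :
    inner 𝕜 f g = ∫ t, g' t * (starRingEnd 𝕜) (f' t) ∂unitMeasure := by
  rw [L2.inner_def]
  refine integral_congr_ae ?_
  filter_upwards [hf, hg] with t h1 h2
  rw [h1, h2, RCLike.inner_apply]

/-- A Hankel operator with a degenerate kernel has finite rank. -/
theorem hankelOp_eq_sum_smulRight {κ : C(ℝ, ℝ)} {ι : Type*} (F : Finset ι) {φ ψ : ι → ℝ → ℝ}
    {f g : ι → Lp 𝕜 2 unitMeasure} (hf : ∀ i, f i =ᵐ[unitMeasure] fun t => (φ i t : 𝕜))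
    (hg : ∀ i, g i =ᵐ[unitMeasure] fun t => (ψ i t : 𝕜))
    (h : ∀ t s, κ (t + s - 1) = ∑ i ∈ F, φ i t * ψ i s) :
    hankelOp 𝕜 κ = ∑ i ∈ F, (innerSL 𝕜 (g i)).smulRight (f i) := by
  ext1 y
  refine Lp.ext ?_
  rw [sum_apply]
  have hf' : ∀ᵐ t ∂unitMeasure, ∀ i ∈ F, ((innerSL 𝕜 (g i)).smulRight (f i) y) t =
      inner 𝕜 (g i) y * (φ i t : 𝕜) := by
    rw [Finset.eventually_all]
    intro i hi
    filter_upwards [hf i, Lp.coeFn_smul (innerSL 𝕜 (g i) y) (f i)] with t h1 h2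
    rw [ContinuousLinearMap.smulRight_apply, h2, Pi.smul_apply, h1, innerSL_apply_apply,
      smul_eq_mul]
  filter_upwards [coeFn_hankelOp κ y, hf', Lp.coeFn_finsetSum F
    (fun i => (innerSL 𝕜 (g i)).smulRight (f i) y)] with t h1 h2 h3
  rw [h1, h3, Finset.sum_apply, Finset.sum_congr rfl h2, hankel]
  have h4 : ∀ i, Integrable (fun s => (ψ i s : 𝕜) * y s) unitMeasure := by
    intro i
    refine (L2.integrable_inner (𝕜 := 𝕜) (g i) y).congr ?_
    filter_upwards [hg i] with s hs
    rw [hs, RCLike.inner_apply, RCLike.conj_ofReal, mul_comm]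
  have h5 : ∀ i, inner 𝕜 (g i) y = ∫ s, (ψ i s : 𝕜) * y s ∂unitMeasure := by
    intro i
    rw [inner_Lp_eq_integral (hg i) (ae_eq_refl _)]
    simp only [RCLike.conj_ofReal, mul_comm]
  simp only [h5, ← integral_mul_const]
  rw [← integral_finsetSum _ fun i _ => (h4 i).mul_const _]
  congr 1
  funext s
  rw [h, RCLike.ofReal_sum, Finset.sum_mul]
  refine Finset.sum_congr rfl fun i _ => ?_
  rw [RCLike.ofReal_mul]
  ring

theorem isCompactOperator_smulRight {H : Type*} [NormedAddCommGroup H] [NormedSpace 𝕜 H]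
    (l : H →L[𝕜] 𝕜) (x : H) : IsCompactOperator (l.smulRight x) := by
  have h := (isCompactOperator_id (E := 𝕜)).comp_clm l
  exact h.clm_comp (ContinuousLinearMap.toSpanSingleton 𝕜 x)

/-- Expanding (t + (s-1))ⁿ by the binomial theorem makes the kernel degenerate, so the operator has
finite rank. -/
theorem isCompactOperator_hankelOp_polynomial (p : Polynomial ℝ) :
    IsCompactOperator (hankelOp 𝕜 p.toContinuousMap) := by
  have hadd : ∀ κ₁ κ₂ : C(ℝ, ℝ), IsCompactOperator (hankelOp 𝕜 κ₁) →
      IsCompactOperator (hankelOp 𝕜 κ₂) → IsCompactOperator (hankelOp 𝕜 (κ₁ + κ₂)) := by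
    intro κ₁ κ₂ h₁ h₂
    rw [hankelOp_add]
    exact h₁.add h₂
  induction p using Polynomial.induction_on' with
  | add p q hp hq =>
    have : (p + q).toContinuousMap = p.toContinuousMap + q.toContinuousMap := by ext; simp
    rw [this]
    exact hadd _ _ hp hq
  | monomial n c =>
    have hmem : ∀ φ : ℕ → ℝ → ℝ, (∀ i, Continuous (φ i)) →
        ∀ i, MemLp (fun t => (φ i t : 𝕜)) 2 unitMeasure := fun φ hφ i =>
      memLp_unitMeasure_of_continuous (RCLike.continuous_ofReal.comp (hφ i))
    let φ : ℕ → ℝ → ℝ := fun i t => t ^ i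
    let ψ : ℕ → ℝ → ℝ := fun i s => c * (s - 1) ^ (n - i) * n.choose i
    have hφ : ∀ i, Continuous (φ i) := fun i => by fun_prop
    have hψ : ∀ i, Continuous (ψ i) := fun i => by fun_prop
    rw [hankelOp_eq_sum_smulRight (Finset.range (n + 1)) (fun i => (hmem φ hφ i).coeFn_toLp)
      (fun i => (hmem ψ hψ i).coeFn_toLp) fun t s => ?_]
    · exact (compactOperator (RingHom.id 𝕜) _ _).sum_mem fun i _ =>
        isCompactOperator_smulRight _ _
    · simp only [Polynomial.toContinuousMap_apply, Polynomial.eval_monomial, φ, ψ]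
      rw [add_sub_assoc, add_pow, Finset.mul_sum]
      exact Finset.sum_congr rfl fun i _ => by ring

/-- Weierstrass approximation on [-1,1] gives approximation in operator norm, and compact operators
form a closed set. -/
theorem isCompactOperator_hankelOp (κ : C(ℝ, ℝ)) : IsCompactOperator (hankelOp 𝕜 κ) := by
  have hcl := isClosed_setOfPred_isCompactOperator (σ₁₂ := RingHom.id 𝕜)
    (M₁ := Lp 𝕜 2 unitMeasure) (M₂ := Lp 𝕜 2 unitMeasure)
  refine hcl.closure_subset (Metric.mem_closure_iff.2 fun ε hε => ?_)
  obtain ⟨p, hp⟩ := exists_polynomial_near_of_continuousOn (-1) 1 κ κ.continuous.continuousOn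
    (ε / 2) (by positivity)
  refine ⟨_, isCompactOperator_hankelOp_polynomial p, ?_⟩
  rw [dist_comm, dist_eq_norm, ← hankelOp_sub]
  refine (norm_hankelOp_le (C := ε / 2) fun x hx => ?_).trans_lt (by linarith)
  simpa using (hp x hx).le

/-- The kernel is real and unchanged when s and t are exchanged; the rest is Fubini. -/
theorem hankelOp_isSymmetric (κ : C(ℝ, ℝ)) :
    (hankelOp 𝕜 κ : Lp 𝕜 2 unitMeasure →ₗ[𝕜] Lp 𝕜 2 unitMeasure).IsSymmetric := by
  intro f g
  change inner 𝕜 (hankelOp 𝕜 κ f) g = inner 𝕜 f (hankelOp 𝕜 κ g)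
  rw [inner_Lp_eq_integral (coeFn_hankelOp κ f) (ae_eq_refl _),
    inner_Lp_eq_integral (ae_eq_refl _) (coeFn_hankelOp κ g)]
  have hf := integrable_unitMeasure_Lp f
  have hg := integrable_unitMeasure_Lp g
  have hf' : Integrable (fun s => (starRingEnd 𝕜) (f s)) unitMeasure :=
    hf.norm.mono' (RCLike.continuous_conj.comp_aestronglyMeasurable hf.1) (by simp)
  obtain ⟨C, hC0, hC⟩ := exists_abs_le_of_continuous κ (-1) 1
  have hint : Integrable
      (fun p : ℝ × ℝ => (κ (p.1 + p.2 - 1) : 𝕜) * (g p.1 * (starRingEnd 𝕜) (f p.2)))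
      (unitMeasure.prod unitMeasure) := by
    have h1 := hg.mul_prod hf'
    refine (h1.norm.const_mul C).mono' ?_ ?_
    · refine AEStronglyMeasurable.mul (Continuous.aestronglyMeasurable ?_) h1.1
      fun_prop
    · have h2 : ∀ᵐ p ∂unitMeasure.prod unitMeasure, p ∈ Ioo (0 : ℝ) 1 ×ˢ Ioo (0 : ℝ) 1 := by
        rw [Measure.prod_restrict]
        exact ae_restrict_mem (measurableSet_Ioo.prod measurableSet_Ioo)
      filter_upwards [h2] with p hp
      rw [norm_mul, RCLike.norm_ofReal]
      exact mul_le_mul_of_nonneg_right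
        (hC _ ⟨by linarith [hp.1.1, hp.2.1], by linarith [hp.1.2, hp.2.2]⟩) (norm_nonneg _)
  have h1 : ∀ t, g t * (starRingEnd 𝕜) (hankel κ f t) =
      ∫ s, (κ (t + s - 1) : 𝕜) * (g t * (starRingEnd 𝕜) (f s)) ∂unitMeasure := by
    intro t
    rw [hankel, ← integral_conj, ← integral_const_mul]
    congr 1
    funext s
    rw [map_mul, RCLike.conj_ofReal]
    ring
  have h2 : ∀ s, hankel κ g s * (starRingEnd 𝕜) (f s) =
      ∫ t, (κ (t + s - 1) : 𝕜) * (g t * (starRingEnd 𝕜) (f s)) ∂unitMeasure := by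
    intro s
    rw [hankel, ← integral_mul_const]
    congr 1
    funext t
    rw [add_comm s t]
    ring
  simp only [h1, h2]
  exact integral_integral_swap hint

end Hankel

/-! ### The Cauchy problem as an integral equation. -/

section Volterra

variable {𝕜 : Type} [RCLike 𝕜]

theorem HasDerivAt.rclikeOfReal {f : ℝ → ℝ} {f' x : ℝ} (hf : HasDerivAt f f' x) :
    HasDerivAt (fun t => (f t : 𝕜)) (f' : 𝕜) x :=
  (RCLike.ofRealCLM (K := 𝕜)).hasFDerivAt.comp_hasDerivAt x hf

/-- The function `x ↦ sinh (a x⁺) / a`, whose Hankel operator inverts the Cauchy problem. -/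
noncomputable def sinhKernel (a : ℝ) : C(ℝ, ℝ) :=
  ⟨fun x => Real.sinh (a * max x 0) / a, by fun_prop⟩

theorem sinhKernel_apply (a x : ℝ) : sinhKernel a x = Real.sinh (a * max x 0) / a := rfl

/-- This links the symmetric operator to the Cauchy problem: the kernel vanishes for t + s ≤ 1, and
s ↦ 1-s leaves a Volterra integral of the reflected function. -/
theorem hankel_sinhKernel {a : ℝ} {f : ℝ → 𝕜} (hf : Integrable f unitMeasure) {t : ℝ}
    (ht : t ∈ Icc (0 : ℝ) 1) :
    hankel (sinhKernel a) f t =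
      ∫ s in (0 : ℝ)..t, ((Real.sinh (a * (t - s)) / a : ℝ) : 𝕜) * f (1 - s) := by
  have h1 : IntervalIntegrable (fun s => (sinhKernel a (t + s - 1) : 𝕜) * f s) volume 0 1 := by
    rw [intervalIntegrable_iff_integrableOn_Ioo_of_le zero_le_one]
    exact integrable_hankel_integrand _ hf t
  have h2 : IntervalIntegrable (fun s => (sinhKernel a (t - s) : 𝕜) * f (1 - s)) volume 0 1 := by
    have := h1.comp_sub_left 1
    simp only [sub_self, sub_zero] at this
    refine this.symm.congr_ae (ae_of_all _ fun s => ?_)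
    simp only
    congr 3
    ring
  have h3 : hankel (sinhKernel a) f t =
      ∫ s in (0 : ℝ)..1, (sinhKernel a (t - s) : 𝕜) * f (1 - s) := by
    have h4 := intervalIntegral.integral_comp_sub_left (a := 0) (b := 1)
      (fun s => (sinhKernel a (t + s - 1) : 𝕜) * f s) 1
    simp only [sub_self, sub_zero] at h4
    rw [hankel, ← integral_Ioc_eq_integral_Ioo, ← intervalIntegral.integral_of_le zero_le_one, ← h4]
    congr 1
    funext s
    congr 3
    ring
  rw [h3, ← intervalIntegral.integral_add_adjacent_intervals (b := t)
    (h2.mono_set (by rw [uIcc_of_le ht.1, uIcc_of_le zero_le_one]; exact Icc_subset_Icc_right ht.2))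
    (h2.mono_set (by rw [uIcc_of_le ht.2, uIcc_of_le zero_le_one]; exact Icc_subset_Icc_left ht.1))]
  have h5 : ∫ s in t..1, (sinhKernel a (t - s) : 𝕜) * f (1 - s) = 0 := by
    rw [intervalIntegral.integral_congr (g := fun _ => (0 : 𝕜))]
    · simp
    · intro s hs
      rw [uIcc_of_le ht.2] at hs
      simp [sinhKernel_apply, max_eq_right (sub_nonpos.2 hs.1)]
  rw [h5, add_zero]
  refine intervalIntegral.integral_congr fun s hs => ?_
  rw [uIcc_of_le ht.1] at hs
  simp only [sinhKernel_apply, max_eq_left (sub_nonneg.2 hs.2)]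

/-- Solutions of `y'' = a² y + g` with zero Cauchy data are given by variation of parameters. -/
theorem eq_integral_sinh_of_cauchy {a : ℝ} (ha : a ≠ 0) {y g : ℝ → 𝕜}
    (hy : ContDiffOn ℝ 2 y (Icc 0 1)) (h0 : y 0 = 0) (h1 : derivWithin y (Icc 0 1) 0 = 0)
    (hg : ContinuousOn g (Icc 0 1))
    (hyg : ∀ s ∈ Ioo (0 : ℝ) 1,
      iteratedDerivWithin 2 y (Icc 0 1) s - ((a ^ 2 : ℝ) : 𝕜) * y s = g s)
    {t : ℝ} (ht : t ∈ Icc (0 : ℝ) 1) :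
    y t = ∫ s in (0 : ℝ)..t, ((Real.sinh (a * (t - s)) / a : ℝ) : 𝕜) * g s := by
  have hud : UniqueDiffOn ℝ (Icc (0 : ℝ) 1) := uniqueDiffOn_Icc zero_lt_one
  have hy1 : ContDiffOn ℝ 1 (derivWithin y (Icc 0 1)) (Icc 0 1) := hy.derivWithin hud (by norm_num)
  have hsub : Icc 0 t ⊆ Icc (0 : ℝ) 1 := Icc_subset_Icc_right ht.2
  have hmem : ∀ s ∈ Ioo 0 t, Icc (0 : ℝ) 1 ∈ nhds s := fun s hs =>
    Icc_mem_nhds hs.1 (hs.2.trans_le ht.2)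
  -- Chosen so that F(t) = y(t), F(0) = 0 and F' = sinh(a(t-s))/a · (y'' - a²y): the remaining terms
  -- cancel.
  let F : ℝ → 𝕜 := fun s => ((Real.cosh (a * (t - s)) : ℝ) : 𝕜) * y s +
    ((Real.sinh (a * (t - s)) / a : ℝ) : 𝕜) * derivWithin y (Icc 0 1) s
  have key := intervalIntegral.integral_eq_sub_of_hasDerivAt_of_le (f := F)
    (f' := fun s => ((Real.sinh (a * (t - s)) / a : ℝ) : 𝕜) * g s) ht.1 ?_ ?_ ?_
  · rw [key]
    simp [F, h0, h1]
  · refine ContinuousOn.add ?_ ?_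
    · exact (Continuous.continuousOn (by fun_prop)).mul (hy.continuousOn.mono hsub)
    · exact (Continuous.continuousOn (by fun_prop)).mul (hy1.continuousOn.mono hsub)
  · intro s hs
    have hs1 : s ∈ Icc (0 : ℝ) 1 := hsub (Ioo_subset_Icc_self hs)
    have d0 : HasDerivAt y (derivWithin y (Icc 0 1) s) s :=
      ((hy.differentiableOn (by norm_num)) s hs1).hasDerivWithinAt.hasDerivAt (hmem s hs)
    have d1 : HasDerivAt (derivWithin y (Icc 0 1)) (iteratedDerivWithin 2 y (Icc 0 1) s) s := by
      have := ((hy1.differentiableOn (by norm_num)) s hs1).hasDerivWithinAt.hasDerivAt (hmem s hs)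
      rwa [show iteratedDerivWithin 2 y (Icc 0 1) s =
        derivWithin (derivWithin y (Icc 0 1)) (Icc 0 1) s from
          congrFun (iteratedDerivWithin_succ' (n := 1) |>.trans iteratedDerivWithin_one) s]
    have dl : HasDerivAt (fun s : ℝ => a * (t - s)) (-a) s := by
      simpa using ((hasDerivAt_id s).const_sub t).const_mul a
    have dc := (dl.cosh).rclikeOfReal (𝕜 := 𝕜)
    have ds := ((dl.sinh).div_const a).rclikeOfReal (𝕜 := 𝕜)
    refine ((dc.mul d0).add (ds.mul d1)).congr_deriv ?_
    rw [← hyg s ⟨hs.1, hs.2.trans_le ht.2⟩]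
    have ha' : (a : 𝕜) ≠ 0 := RCLike.ofReal_ne_zero.2 ha
    push_cast
    field_simp
    ring
  · refine ContinuousOn.intervalIntegrable ?_
    rw [uIcc_of_le ht.1]
    exact (Continuous.continuousOn (by fun_prop)).mul (hg.mono hsub)

theorem IsCauchyEigenfunction1D.eq_mul_hankel {a : ℝ} (ha : a ≠ 0) {z : 𝕜} {y : ℝ → 𝕜}
    (h : IsCauchyEigenfunction1D (a ^ 2) z y) {t : ℝ} (ht : t ∈ Icc (0 : ℝ) 1) :
    y t = z * hankel (sinhKernel a) y t := by
  have hmaps : MapsTo (fun s : ℝ => 1 - s) (Icc 0 1) (Icc 0 1) := fun s hs =>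
    ⟨by linarith [hs.2], by linarith [hs.1]⟩
  have hint : Integrable y unitMeasure :=
    (h.contDiffOn.continuousOn.integrableOn_Icc (μ := volume)).mono_set Ioo_subset_Icc_self
  rw [eq_integral_sinh_of_cauchy ha h.contDiffOn h.initial h.initial_deriv
    (g := fun s => z * y (1 - s)) ?_ h.equation ht, hankel_sinhKernel hint ht,
    ← intervalIntegral.integral_const_mul]
  · congr 1
    funext s
    ring
  · exact continuousOn_const.mul (h.contDiffOn.continuousOn.comp (by fun_prop) hmaps)

/-- Variation of parameters solves `v'' = a² v + g` with zero Cauchy data. -/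
theorem exists_hasDerivAt_integral_sinh {a : ℝ} (ha : a ≠ 0) {g : ℝ → 𝕜} (hg : Continuous g) :
    ∃ v v' : ℝ → 𝕜, (∀ t, v t = ∫ s in (0 : ℝ)..t, ((Real.sinh (a * (t - s)) / a : ℝ) : 𝕜) * g s) ∧
      v' 0 = 0 ∧ (∀ t, HasDerivAt v (v' t) t) ∧
      ∀ t, HasDerivAt v' (((a ^ 2 : ℝ) : 𝕜) * v t + g t) t := by
  have ha' : (a : 𝕜) ≠ 0 := RCLike.ofReal_ne_zero.2 ha
  -- The addition formula for sinh(a(t-s)) separates t from s, leaving integrands independent of the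
  -- upper limit.
  let C : ℝ → 𝕜 := fun t => ∫ s in (0 : ℝ)..t, ((Real.cosh (a * s) : ℝ) : 𝕜) * g s
  let S : ℝ → 𝕜 := fun t => ∫ s in (0 : ℝ)..t, ((Real.sinh (a * s) : ℝ) : 𝕜) * g s
  have hc : Continuous fun s => ((Real.cosh (a * s) : ℝ) : 𝕜) * g s := by fun_prop
  have hs : Continuous fun s => ((Real.sinh (a * s) : ℝ) : 𝕜) * g s := by fun_prop
  have hC : ∀ t, HasDerivAt C (((Real.cosh (a * t) : ℝ) : 𝕜) * g t) t := fun t =>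
    intervalIntegral.integral_hasDerivAt_right (hc.intervalIntegrable _ _)
      (hc.stronglyMeasurableAtFilter _ _) hc.continuousAt
  have hS : ∀ t, HasDerivAt S (((Real.sinh (a * t) : ℝ) : 𝕜) * g t) t := fun t =>
    intervalIntegral.integral_hasDerivAt_right (hs.intervalIntegrable _ _)
      (hs.stronglyMeasurableAtFilter _ _) hs.continuousAt
  have dl : ∀ t, HasDerivAt (fun s : ℝ => a * s) a t := fun t => by
    simpa using (hasDerivAt_id t).const_mul a
  have dc := fun t => (dl t).cosh.rclikeOfReal (𝕜 := 𝕜)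
  have ds := fun t => (dl t).sinh.rclikeOfReal (𝕜 := 𝕜)
  have hcs : ∀ t, (Real.cosh (a * t) : 𝕜) ^ 2 = 1 + (Real.sinh (a * t) : 𝕜) ^ 2 := fun t => by
    exact_mod_cast (Real.cosh_sq' (a * t))
  refine ⟨fun t => (a : 𝕜)⁻¹ * (((Real.sinh (a * t) : ℝ) : 𝕜) * C t -
    ((Real.cosh (a * t) : ℝ) : 𝕜) * S t), fun t => ((Real.cosh (a * t) : ℝ) : 𝕜) * C t -
    ((Real.sinh (a * t) : ℝ) : 𝕜) * S t, fun t => ?_, ?_, fun t => ?_, fun t => ?_⟩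
  · simp only [C, S]
    rw [← intervalIntegral.integral_const_mul, ← intervalIntegral.integral_const_mul,
      ← intervalIntegral.integral_sub ((hc.intervalIntegrable _ _).const_mul _)
        ((hs.intervalIntegrable _ _).const_mul _), ← intervalIntegral.integral_const_mul]
    congr 1
    funext s
    rw [mul_sub a t s, Real.sinh_sub]
    push_cast
    field_simp
  · simp [C]
  · refine ((((ds t).mul (hC t)).sub ((dc t).mul (hS t))).const_mul _).congr_deriv ?_
    push_cast
    field_simp
    ring
  · refine (((dc t).mul (hC t)).sub ((ds t).mul (hS t))).congr_deriv ?_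
    push_cast
    field_simp
    linear_combination (g t) * hcs t

/-- Eigenvectors of the Hankel operator have representatives solving the Cauchy problem. -/
theorem exists_isCauchyEigenfunction1D {a : ℝ} (ha : a ≠ 0) {b : Lp 𝕜 2 unitMeasure} (hb0 : b ≠ 0)
    {ν : ℝ} (hν : ν ≠ 0) (hb : hankelOp 𝕜 (sinhKernel a) b = (ν : 𝕜) • b) :
    ∃ v : ℝ → 𝕜, b =ᵐ[unitMeasure] v ∧
      IsCauchyEigenfunction1D (a ^ 2) ((ν⁻¹ : ℝ) : 𝕜) v := by
  have hν' : (ν : 𝕜) ≠ 0 := RCLike.ofReal_ne_zero.2 hν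
  have hbint := integrable_unitMeasure_Lp b
  -- The eigenvalue relation supplies a continuous representative. Its Volterra form on [0,1] then
  -- gives a representative v that is C² on the whole line.
  let w : ℝ → 𝕜 := fun t => (ν : 𝕜)⁻¹ * hankel (sinhKernel a) b t
  have hw : Continuous w := continuous_const.mul (continuous_hankel _ hbint)
  have hbw : b =ᵐ[unitMeasure] w := by
    have h1 := coeFn_hankelOp (sinhKernel a) b
    rw [hb] at h1
    filter_upwards [h1, Lp.coeFn_smul (ν : 𝕜) b] with t h1 h2
    simp only [w]
    rw [← h1, h2, Pi.smul_apply, smul_eq_mul, inv_mul_cancel_left₀ hν']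
  obtain ⟨v, v', hv, hv'0, hvd, hvd'⟩ := exists_hasDerivAt_integral_sinh (𝕜 := 𝕜) ha
    (g := fun s => (ν : 𝕜)⁻¹ * w (1 - s)) (by fun_prop)
  have hvw : ∀ t ∈ Icc (0 : ℝ) 1, v t = w t := by
    intro t ht
    have h1 : w t = (ν : 𝕜)⁻¹ * hankel (sinhKernel a) w t :=
      congrArg ((ν : 𝕜)⁻¹ * ·) (hankel_congr_ae _ hbw t)
    rw [h1, hv, hankel_sinhKernel (hbint.congr hbw) ht, ← intervalIntegral.integral_const_mul]
    congr 1
    funext s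
    ring
  have hbv : b =ᵐ[unitMeasure] v := by
    filter_upwards [hbw, ae_unitMeasure_mem] with t h1 h2
    rw [h1, hvw t (Ioo_subset_Icc_self h2)]
  have hderiv : deriv v = v' := funext fun t => (hvd t).deriv
  have hderiv' : deriv v' = fun t => ((a ^ 2 : ℝ) : 𝕜) * v t + (ν : 𝕜)⁻¹ * w (1 - t) :=
    funext fun t => (hvd' t).deriv
  have hvcont : Continuous v := continuous_iff_continuousAt.2 fun t => (hvd t).continuousAt
  have hC2 : ContDiff ℝ 2 v := by
    rw [show (2 : WithTop ℕ∞) = 1 + 1 by norm_num, contDiff_succ_iff_deriv]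
    refine ⟨fun t => (hvd t).differentiableAt, by simp, ?_⟩
    rw [hderiv, contDiff_one_iff_deriv]
    refine ⟨fun t => (hvd' t).differentiableAt, ?_⟩
    rw [hderiv']
    fun_prop
  have hud : UniqueDiffOn ℝ (Icc (0 : ℝ) 1) := uniqueDiffOn_Icc zero_lt_one
  refine ⟨v, hbv, hC2.contDiffOn, by simp [hv], ?_, fun t ht => ?_, ?_⟩
  · rw [(hvd 0).hasDerivWithinAt.derivWithin (hud 0 (by simp)), hv'0]
  · have ht' := Ioo_subset_Icc_self ht
    rw [iteratedDerivWithin_eq_iteratedDeriv hud hC2.contDiffAt ht', iteratedDeriv_succ',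
      iteratedDeriv_one, hderiv, hderiv', hvw (1 - t) ⟨by linarith [ht'.2], by linarith [ht'.1]⟩]
    push_cast
    ring
  · by_contra! hcon
    refine hb0 ((Lp.eq_zero_iff_ae_eq_zero).2 ?_)
    filter_upwards [hbv, ae_unitMeasure_mem] with t h1 h2
    rw [h1, hcon t (Ioo_subset_Icc_self h2), Pi.zero_apply]

/-- Every test function y is the image of s ↦ (y'' - a²y)(1-s), its Cauchy data at 0 being zero. By
symmetry an element of the kernel is orthogonal to all test functions. -/
theorem hankelOp_sinhKernel_injective {a : ℝ} (ha : a ≠ 0) (f : Lp 𝕜 2 unitMeasure)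
    (hf : hankelOp 𝕜 (sinhKernel a) f = 0) : f = 0 := by
  have hud : UniqueDiffOn ℝ (Icc (0 : ℝ) 1) := uniqueDiffOn_Icc zero_lt_one
  have hfint := integrable_unitMeasure_Lp f
  have key : ∀ᵐ x : ℝ, x ∈ Ioo (0 : ℝ) 1 → f x = 0 := by
    refine isOpen_Ioo.ae_eq_zero_of_integral_contDiff_smul_eq_zero
      (IntegrableOn.locallyIntegrableOn hfint) fun g hg _ hgs => ?_
    let y : ℝ → 𝕜 := fun t => (g t : 𝕜)
    have hy : ContDiff ℝ 2 y := (RCLike.ofRealCLM (K := 𝕜)).contDiff.comp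
      (hg.of_le (WithTop.coe_le_coe.2 le_top))
    have hy0 : y =ᶠ[nhds 0] 0 := by
      have : (0 : ℝ) ∉ tsupport g := fun h => lt_irrefl _ (hgs h).1
      filter_upwards [notMem_tsupport_iff_eventuallyEq.1 this] with t ht
      simp [y, ht]
    let G : ℝ → 𝕜 := fun s => iteratedDeriv 2 y s - ((a ^ 2 : ℝ) : 𝕜) * y s
    have hG : Continuous G :=
      (hy.continuous_iteratedDeriv 2 le_rfl).sub (continuous_const.mul hy.continuous)
    let h : ℝ → 𝕜 := fun s => G (1 - s)
    have hh : Continuous h := by fun_prop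
    have hhL := memLp_unitMeasure_of_continuous hh
    have hyh : ∀ t ∈ Icc (0 : ℝ) 1, y t = hankel (sinhKernel a) h t := by
      intro t ht
      rw [hankel_sinhKernel (hhL.integrable one_le_two) ht,
        eq_integral_sinh_of_cauchy ha (g := G) hy.contDiffOn hy0.self_of_nhds ?_
          hG.continuousOn ?_ ht]
      · simp only [h, sub_sub_cancel]
      · rw [(hy.differentiable (by norm_num) 0).derivWithin (hud 0 (by simp)), hy0.deriv_eq]
        simp
      · intro s hs
        rw [iteratedDerivWithin_eq_iteratedDeriv hud hy.contDiffAt (Ioo_subset_Icc_self hs)]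
    have h1 := hankelOp_isSymmetric (sinhKernel a) (hhL.toLp h) f
    change inner 𝕜 (hankelOp 𝕜 (sinhKernel a) (hhL.toLp h)) f =
      inner 𝕜 (hhL.toLp h) (hankelOp 𝕜 (sinhKernel a) f) at h1
    rw [hf, inner_zero_right, inner_Lp_eq_integral (f' := y) ?_ (ae_eq_refl _)] at h1
    · rw [← setIntegral_eq_integral_of_forall_compl_eq_zero (s := Ioo (0 : ℝ) 1)]
      · rw [← h1]
        congr 1
        funext t
        simp only [y, RCLike.conj_ofReal, RCLike.real_smul_eq_coe_mul, mul_comm]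
      · intro t ht
        rw [image_eq_zero_of_notMem_tsupport fun h => ht (hgs h), zero_smul]
    · filter_upwards [coeFn_hankelOp (sinhKernel a) (hhL.toLp h), ae_unitMeasure_mem] with t h2 h3
      rw [h2, hankel_congr_ae _ hhL.coeFn_toLp, hyh t (Ioo_subset_Icc_self h3)]
  refine (Lp.eq_zero_iff_ae_eq_zero).2 ?_
  filter_upwards [ae_restrict_of_ae key, ae_unitMeasure_mem] with t h1 h2 using h1 h2

end Volterra

/-! ### Perturbation of a rank one operator. -/

section Perturbation

variable {𝕜 : Type*} [RCLike 𝕜] {H : Type*} [NormedAddCommGroup H] [InnerProductSpace 𝕜 H]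

theorem HilbertBasis.norm_apply_le_of_eigenvalues_le {ι : Type*} (b : HilbertBasis ι 𝕜 H)
    {T : H →L[𝕜] H} (hT : (T : H →ₗ[𝕜] H).IsSymmetric) {ν : ι → ℝ}
    (hb : ∀ i, T (b i) = (ν i : 𝕜) • b i) {M : ℝ} (hM : ∀ i, |ν i| ≤ M) (hM0 : 0 ≤ M) (x : H) :
    ‖T x‖ ≤ M * ‖x‖ := by
  have parseval : ∀ y : H, HasSum (fun i => ‖inner 𝕜 (b i) y‖ ^ 2) (‖y‖ ^ 2) := by
    intro y
    have h := (RCLike.reCLM (K := 𝕜)).hasSum (b.hasSum_inner_mul_inner y y)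
    simp only [RCLike.reCLM_apply, inner_self_eq_norm_sq] at h
    refine h.congr_fun fun i => ?_
    rw [← inner_conj_symm y (b i), RCLike.conj_mul]
    norm_cast
  have h1 := parseval (T x)
  have h2 := (parseval x).mul_left (M ^ 2)
  rw [← mul_pow] at h2
  refine le_of_sq_le_sq (hasSum_le (fun i => ?_) h1 h2) (by positivity)
  have h3 : inner 𝕜 (b i) (T x) = (ν i : 𝕜) * inner 𝕜 (b i) x := by
    have := hT (b i) x
    change inner 𝕜 (T (b i)) x = inner 𝕜 (b i) (T x) at this
    rw [← this, hb, inner_smul_left, RCLike.conj_ofReal]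
  rw [h3, norm_mul, mul_pow, RCLike.norm_ofReal]
  exact mul_le_mul_of_nonneg_right (pow_le_pow_left₀ (abs_nonneg _) (hM i) 2) (by positivity)

/-- The dominant eigenvalue of a small perturbation of a positive rank one operator. -/
theorem HilbertBasis.abs_sub_le_of_rank_one_perturbation {ι : Type*} (b : HilbertBasis ι 𝕜 H)
    {T E : H →L[𝕜] H} (hT : (T : H →ₗ[𝕜] H).IsSymmetric) {ν : ι → ℝ}
    (hb : ∀ i, T (b i) = (ν i : 𝕜) • b i) {i₀ : ι} (hi₀ : ∀ i, |ν i| ≤ |ν i₀|)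
    {φ : H} {c ε : ℝ} (hc : 0 < c) (hE : ‖E‖ ≤ ε)
    (hTE : ∀ x, T x = ((c : 𝕜) * inner 𝕜 φ x) • φ - E x) (hε : 2 * ε < c * ‖φ‖ ^ 2) :
    |ν i₀ - c * ‖φ‖ ^ 2| ≤ ε := by
  have hε0 : 0 ≤ ε := (norm_nonneg E).trans hE
  have hφ : 0 < ‖φ‖ := by
    by_contra h
    rw [le_antisymm (not_lt.1 h) (norm_nonneg φ)] at hε
    norm_num at hε
    linarith
  have hEx : ∀ x, ‖E x‖ ≤ ε * ‖x‖ := fun x => E.le_of_opNorm_le hE x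
  have hb1 : ‖b i₀‖ = 1 := b.orthonormal.1 i₀
  -- Here φ is the trial vector: ‖Tφ‖ is at least (c‖φ‖² - ε)‖φ‖ and at most |ν i₀| ‖φ‖.
  have hlow : c * ‖φ‖ ^ 2 - ε ≤ |ν i₀| := by
    have h1 := b.norm_apply_le_of_eigenvalues_le hT hb hi₀ (abs_nonneg _) φ
    have h2 := norm_sub_norm_le (((c : 𝕜) * inner 𝕜 φ φ) • φ) (E φ)
    rw [← hTE, norm_smul, norm_mul, RCLike.norm_ofReal, abs_of_pos hc,
      inner_self_eq_norm_sq_to_K, norm_pow, RCLike.norm_ofReal, abs_norm] at h2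
    have h3 := hEx φ
    refine le_of_mul_le_mul_right ?_ hφ
    linarith
  have hup : |ν i₀| ≤ c * ‖φ‖ ^ 2 + ε := by
    have h1 : ‖T (b i₀)‖ = |ν i₀| := by
      rw [hb, norm_smul, hb1, mul_one, RCLike.norm_ofReal]
    rw [← h1, hTE]
    refine (norm_sub_le _ _).trans (add_le_add ?_ (by simpa [hb1] using hEx (b i₀)))
    rw [norm_smul, norm_mul, RCLike.norm_ofReal, abs_of_pos hc]
    have h2 := norm_inner_le_norm (𝕜 := 𝕜) φ (b i₀)
    rw [hb1, mul_one] at h2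
    nlinarith [mul_le_mul_of_nonneg_left h2 (mul_pos hc hφ).le]
  -- The rank one part is positive, so the quadratic form at b i₀ is at least -ε. As |ν i₀| exceeds
  -- ε, this settles the sign.
  have hneg : -ε ≤ ν i₀ := by
    have h1 : inner 𝕜 (b i₀) (T (b i₀)) = (ν i₀ : 𝕜) := by
      rw [hb, inner_smul_right, inner_self_eq_norm_sq_to_K, hb1]
      simp
    have h2 : ν i₀ = c * ‖inner 𝕜 φ (b i₀)‖ ^ 2 - RCLike.re (inner 𝕜 (b i₀) (E (b i₀))) := by
      have h3 := congrArg RCLike.re h1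
      rw [RCLike.ofReal_re, hTE, inner_sub_right, inner_smul_right, map_sub,
        ← inner_conj_symm (b i₀) φ, mul_assoc, RCLike.mul_conj, ← RCLike.ofReal_pow,
        ← RCLike.ofReal_mul, RCLike.ofReal_re] at h3
      exact h3.symm
    have h3 : RCLike.re (inner 𝕜 (b i₀) (E (b i₀))) ≤ ε := by
      refine (RCLike.re_le_norm _).trans ((norm_inner_le_norm _ _).trans ?_)
      simpa [hb1] using hEx (b i₀)
    have h4 : 0 ≤ c * ‖inner 𝕜 φ (b i₀)‖ ^ 2 := by positivity
    linarith
  have hpos : 0 ≤ ν i₀ := by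
    by_contra! h
    rw [abs_of_neg h] at hlow
    linarith
  rw [abs_of_nonneg hpos] at hlow hup
  exact abs_le.2 ⟨by linarith, by linarith⟩

end Perturbation

/-! ### Spectrum of the one-dimensional problem. -/

section OneDimensional

variable {𝕜 : Type} [RCLike 𝕜]

theorem integral_exp_sq_unitMeasure {a : ℝ} (ha : a ≠ 0) :
    ∫ t, Real.exp (a * t) * Real.exp (a * t) ∂unitMeasure = (Real.exp (2 * a) - 1) / (2 * a) := by
  rw [← integral_Ioc_eq_integral_Ioo, ← intervalIntegral.integral_of_le zero_le_one]
  have : ∀ t, Real.exp (a * t) * Real.exp (a * t) = Real.exp (2 * a * t) := fun t => by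
    rw [← Real.exp_add]
    ring_nf
  simp only [this]
  rw [intervalIntegral.integral_comp_mul_left (fun x => Real.exp x) (by positivity), integral_exp]
  simp [div_eq_inv_mul]

/-- The kernel `sinh (a x⁺) / a` is a positive rank one kernel up to an error at most `1 / (2a)`. -/
theorem exists_hankelOp_sinhKernel_eq {a : ℝ} (ha : 0 < a) :
    ∃ (φ : Lp 𝕜 2 unitMeasure) (E : Lp 𝕜 2 unitMeasure →L[𝕜] Lp 𝕜 2 unitMeasure),
      ‖φ‖ ^ 2 = (Real.exp (2 * a) - 1) / (2 * a) ∧ ‖E‖ ≤ 1 / (2 * a) ∧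
      ∀ x, hankelOp 𝕜 (sinhKernel a) x =
        (((Real.exp (-a) / (2 * a) : ℝ) : 𝕜) * inner 𝕜 φ x) • φ - E x := by
  have hφ : MemLp (fun t : ℝ => ((Real.exp (a * t) : ℝ) : 𝕜)) 2 unitMeasure :=
    memLp_unitMeasure_of_continuous (by fun_prop)
  let κ₁ : C(ℝ, ℝ) := ⟨fun x => Real.exp (a * x) / (2 * a), by fun_prop⟩
  let κ₂ : C(ℝ, ℝ) := ⟨fun x => Real.exp (-(a * |x|)) / (2 * a), by fun_prop⟩
  let c : ℝ := Real.exp (-a) / (2 * a)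
  -- For x ≥ 0 this is the definition of sinh; for x ≤ 0 the two exponentials coincide and cancel.
  have hκ : sinhKernel a = κ₁ - κ₂ := by
    ext x
    change Real.sinh (a * max x 0) / a = Real.exp (a * x) / (2 * a) -
      Real.exp (-(a * |x|)) / (2 * a)
    rcases le_total 0 x with hx | hx
    · rw [max_eq_left hx, abs_of_nonneg hx, Real.sinh_eq]
      field_simp
    · rw [max_eq_right hx, abs_of_nonpos hx]
      simp
  have h₁ : hankelOp 𝕜 κ₁ = (innerSL 𝕜 ((c : 𝕜) • hφ.toLp _)).smulRight (hφ.toLp _) := by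
    rw [hankelOp_eq_sum_smulRight (𝕜 := 𝕜) {()} (φ := fun _ t => Real.exp (a * t))
      (ψ := fun _ s => c * Real.exp (a * s)) (f := fun _ => hφ.toLp _)
      (g := fun _ => (c : 𝕜) • hφ.toLp _) (fun _ => hφ.coeFn_toLp) (fun _ => ?_) fun t s => ?_]
    · simp
    · filter_upwards [Lp.coeFn_smul (c : 𝕜) (hφ.toLp _), hφ.coeFn_toLp] with s h1 h2
      rw [h1, Pi.smul_apply, h2, smul_eq_mul, RCLike.ofReal_mul]
    · simp only [κ₁, c, ContinuousMap.coe_mk, Finset.sum_singleton]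
      rw [show a * (t + s - 1) = a * t + (-a + a * s) by ring, Real.exp_add, Real.exp_add]
      ring
  refine ⟨hφ.toLp _, hankelOp 𝕜 κ₂, ?_, norm_hankelOp_le fun x _ => ?_, fun x => ?_⟩
  · have h : inner 𝕜 (hφ.toLp _) (hφ.toLp _) =
        ((∫ t, Real.exp (a * t) * Real.exp (a * t) ∂unitMeasure : ℝ) : 𝕜) := by
      rw [inner_Lp_eq_integral hφ.coeFn_toLp hφ.coeFn_toLp, ← integral_ofReal]
      simp only [RCLike.conj_ofReal, RCLike.ofReal_mul]
    rw [integral_exp_sq_unitMeasure ha.ne', inner_self_eq_norm_sq_to_K] at h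
    exact_mod_cast h
  · change |Real.exp (-(a * |x|)) / (2 * a)| ≤ _
    rw [abs_of_pos (by positivity)]
    gcongr
    rw [Real.exp_le_one_iff]
    have := mul_nonneg ha.le (abs_nonneg x)
    linarith
  · rw [hκ, hankelOp_sub, h₁, sub_apply, ContinuousLinearMap.smulRight_apply, innerSL_apply_apply,
      inner_smul_left, RCLike.conj_ofReal]

/-- The eigenfunctions of the one-dimensional problem. -/
theorem exists_hilbertBasis_isCauchyEigenfunction1D {a : ℝ} (ha : 0 < a) :
    ∃ (lam : ℕ → ℝ) (v : ℕ → ℝ → 𝕜) (b : HilbertBasis ℕ 𝕜 (Lp 𝕜 2 unitMeasure)),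
      (∀ m, b m =ᵐ[unitMeasure] v m) ∧
      (∀ m, IsCauchyEigenfunction1D (a ^ 2) (lam m : 𝕜) (v m)) ∧
      (∀ (z : 𝕜) y, IsCauchyEigenfunction1D (a ^ 2) z y → ∃ m, (lam m : 𝕜) = z) ∧
      (∀ m, |lam 0| ≤ |lam m|) ∧
      (Real.exp (-(2 * a)) + 4 * (a * Real.exp (-a)) < 1 →
        |4 * a ^ 2 * Real.exp (-a) * (lam 0)⁻¹ - 1| ≤
          Real.exp (-(2 * a)) + 2 * (a * Real.exp (-a))) := by
  have hsymm := hankelOp_isSymmetric (𝕜 := 𝕜) (sinhKernel a)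
  obtain ⟨b, ν, hb, hν, hanti⟩ :=
    (isCompactOperator_hankelOp (𝕜 := 𝕜) (sinhKernel a)).exists_hilbertBasis_eigenvectors hsymm
      (hankelOp_sinhKernel_injective ha.ne')
      (not_finiteDimensional_Lp_restrict 𝕜 volume isOpen_Ioo (Ioo_infinite zero_lt_one) (by simp))
  choose v hbv hv using fun m =>
    exists_isCauchyEigenfunction1D ha.ne' (b.orthonormal.ne_zero m) (hν m) (hb m)
  refine ⟨fun m => (ν m)⁻¹, v, b, hbv, hv, fun z y hy => ?_, fun m => ?_, fun hsmall => ?_⟩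
  · have hyc := hy.contDiffOn.continuousOn
    have hyL : MemLp y 2 unitMeasure := by
      obtain ⟨C, hC⟩ := isCompact_Icc.exists_bound_of_continuousOn hyc
      refine MemLp.of_bound
        ((hyc.mono Ioo_subset_Icc_self).aestronglyMeasurable measurableSet_Ioo) C ?_
      filter_upwards [ae_unitMeasure_mem] with t ht using hC t (Ioo_subset_Icc_self ht)
    have hz : z ≠ 0 := by
      rintro rfl
      obtain ⟨t, ht, h⟩ := hy.nonzero
      exact h (by rw [hy.eq_mul_hankel ha.ne' ht, zero_mul])
    have hyne : hyL.toLp y ≠ 0 := by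
      intro h0
      have h1 : y =ᵐ[unitMeasure] 0 := by
        filter_upwards [hyL.coeFn_toLp, Lp.eq_zero_iff_ae_eq_zero.1 h0] with t h1 h2
        rw [← h1, h2]
      obtain ⟨t, ht, h⟩ := hy.nonzero
      apply h
      rw [hy.eq_mul_hankel ha.ne' ht, hankel_congr_ae _ h1]
      simp [hankel]
    have hyT : hyL.toLp y = z • hankelOp 𝕜 (sinhKernel a) (hyL.toLp y) := by
      refine Lp.ext ?_
      filter_upwards [hyL.coeFn_toLp, coeFn_hankelOp (sinhKernel a) (hyL.toLp y),
        Lp.coeFn_smul z (hankelOp 𝕜 (sinhKernel a) (hyL.toLp y)), ae_unitMeasure_mem]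
        with t h1 h2 h3 h4
      rw [h1, h3, Pi.smul_apply, h2, hankel_congr_ae _ hyL.coeFn_toLp,
        hy.eq_mul_hankel ha.ne' (Ioo_subset_Icc_self h4), smul_eq_mul]
    by_contra! hcon
    refine hyne (b.repr.injective ?_)
    rw [map_zero]
    ext m
    rw [b.repr_apply_apply, lp.coeFn_zero, Pi.zero_apply]
    have h1 := hsymm (b m) (hyL.toLp y)
    change inner 𝕜 (hankelOp 𝕜 (sinhKernel a) (b m)) (hyL.toLp y) =
      inner 𝕜 (b m) (hankelOp 𝕜 (sinhKernel a) (hyL.toLp y)) at h1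
    rw [hb, inner_smul_left, RCLike.conj_ofReal] at h1
    -- Each coefficient equals z ν_m times itself, so all of them vanish unless z is some 1/ν_m.
    have h2 : inner 𝕜 (b m) (hyL.toLp y) = z * ((ν m : 𝕜) * inner 𝕜 (b m) (hyL.toLp y)) := by
      rw [h1, ← inner_smul_right, ← hyT]
    by_contra h3
    apply hcon m
    have h4 : z * (ν m : 𝕜) = 1 := mul_right_cancel₀ h3 (by rw [one_mul, mul_assoc, ← h2])
    rw [RCLike.ofReal_inv, eq_comm]
    exact eq_inv_of_mul_eq_one_left h4
  · rw [abs_inv, abs_inv]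
    exact inv_anti₀ (abs_pos.2 (hν m)) (hanti (Nat.zero_le m))
  · obtain ⟨φ, E, hφ, hE, hTE⟩ := exists_hankelOp_sinhKernel_eq (𝕜 := 𝕜) ha
    have hexp : Real.exp (-(2 * a)) = Real.exp (-a) * Real.exp (-a) := by
      rw [← Real.exp_add]
      ring_nf
    have hexp' : Real.exp (-a) * Real.exp (-a) * Real.exp (2 * a) = 1 := by
      rw [← hexp, ← Real.exp_add]
      simp
    set e := Real.exp (-a) with he
    have hepos : 0 < e := Real.exp_pos _
    -- Scaling by 4a²e^{-a} turns c‖φ‖² into 1 - e^{-2a} and the error 1/(2a) into 2ae^{-a}; the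
    -- smallness hypothesis is then 2ε < c‖φ‖².
    have hN : 4 * a ^ 2 * e * (e / (2 * a) * ‖φ‖ ^ 2) = 1 - e * e := by
      rw [hφ]
      generalize Real.exp (2 * a) = X at hexp'
      field_simp
      linear_combination 4 * hexp'
    have hε : 4 * a ^ 2 * e * (1 / (2 * a)) = 2 * (a * e) := by
      field_simp
      ring
    have hpos : 0 < 4 * a ^ 2 * e := by positivity
    have key := b.abs_sub_le_of_rank_one_perturbation hsymm hb (i₀ := 0)
      (fun i => hanti (Nat.zero_le i)) (c := e / (2 * a)) (by positivity) hE hTE (by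
        refine lt_of_mul_lt_mul_left ?_ hpos.le
        rw [hN]
        linarith)
    have key' := mul_le_mul_of_nonneg_left key hpos.le
    rw [← abs_of_pos hpos, ← abs_mul, abs_of_pos hpos, mul_sub, hN, hε] at key'
    rw [inv_inv, hexp]
    have h5 : 4 * a ^ 2 * e * ν 0 - 1 = (4 * a ^ 2 * e * ν 0 - (1 - e * e)) + -(e * e) := by ring
    rw [h5]
    refine (abs_add_le _ _).trans ?_
    rw [abs_neg, abs_of_pos (mul_pos hepos hepos)]
    linarith

end OneDimensional

/-! ### Product bases in L² of a product. -/

section Tensor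

/-- Products of orthonormal bases of two `L²` spaces form an orthonormal basis of the `L²` space of
the product measure; the second basis may vary with the element of the first one. -/
theorem exists_hilbertBasis_prod {𝕜 : Type*} [RCLike 𝕜] {X Y ι κ : Type*} [Countable ι]
    [MeasurableSpace X] [MeasurableSpace Y] (α : Measure X) (β : Measure Y)
    [SFinite α] [SFinite β] (u : HilbertBasis ι 𝕜 (Lp 𝕜 2 α))
    (b : ι → HilbertBasis κ 𝕜 (Lp 𝕜 2 β)) :
    ∃ w : HilbertBasis (ι × κ) 𝕜 (Lp 𝕜 2 (α.prod β)), ∀ i j,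
      (w (i, j) : X × Y → 𝕜) =ᵐ[α.prod β] fun p => u i p.1 * b i j p.2 := by
  have hmem : ∀ q : ι × κ, MemLp (fun p : X × Y => u q.1 p.1 * b q.1 q.2 p.2) 2 (α.prod β) := by
    intro q
    have h1 := Lp.memLp (u q.1)
    have h2 := Lp.memLp (b q.1 q.2)
    refine (memLp_two_iff_integrable_sq_norm (h1.1.comp_fst.mul h2.1.comp_snd)).2 ?_
    refine (((memLp_two_iff_integrable_sq_norm h1.1).1 h1).mul_prod
      ((memLp_two_iff_integrable_sq_norm h2.1).1 h2)).congr (ae_of_all _ fun p => ?_)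
    simp [mul_pow]
  let e : ι × κ → Lp 𝕜 2 (α.prod β) := fun q => (hmem q).toLp _
  have horth : Orthonormal 𝕜 e := by
    classical
    rw [orthonormal_iff_ite]
    intro q r
    have h1 : inner 𝕜 (e q) (e r) =
        inner 𝕜 (u q.1) (u r.1) * inner 𝕜 (b q.1 q.2) (b r.1 r.2) := by
      rw [L2.inner_def, L2.inner_def, L2.inner_def, ← integral_prod_mul]
      refine integral_congr_ae ?_
      filter_upwards [(hmem q).coeFn_toLp, (hmem r).coeFn_toLp] with p hq hr
      rw [hq, hr]
      simp only [RCLike.inner_apply, map_mul]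
      ring
    rw [h1, orthonormal_iff_ite.1 u.orthonormal]
    obtain ⟨i, j⟩ := q
    obtain ⟨i', j'⟩ := r
    by_cases hi : i = i'
    · subst hi
      simp only [if_true, one_mul, orthonormal_iff_ite.1 (b i).orthonormal, Prod.mk.injEq, true_and]
    · simp [hi]
  have hcomplete : (Submodule.span 𝕜 (range e))ᗮ = ⊥ := by
    rw [eq_bot_iff]
    intro f hf
    have hfe : ∀ q, inner 𝕜 (e q) f = 0 := fun q =>
      (Submodule.mem_orthogonal _ f).1 hf _ (Submodule.subset_span ⟨q, rfl⟩)
    have hfm := Lp.memLp f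
    have hfsq : Integrable (fun p => ‖f p‖ ^ 2) (α.prod β) :=
      (memLp_two_iff_integrable_sq_norm hfm.1).1 hfm
    have hslice : ∀ᵐ y ∂β, MemLp (fun x => f (x, y)) 2 α := by
      have hswap : AEStronglyMeasurable (fun p : Y × X => f (p.2, p.1)) (β.prod α) :=
        hfm.1.prod_swap
      filter_upwards [hswap.prodMk_left, hfsq.prod_left_ae] with y h1 h2
      exact (memLp_two_iff_integrable_sq_norm h1).2 h2
    -- The i-th coefficient of each slice of f. By Fubini ⟨b i j, F i⟩ = ⟨e (i, j), f⟩ = 0 for all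
    -- j, so completeness of `b i` alone, with i fixed, kills F i.
    let F : ι → Y → 𝕜 := fun i y => ∫ x, f (x, y) * (starRingEnd 𝕜) (u i x) ∂α
    have hFbound : ∀ i, ∀ᵐ y ∂β, ‖F i y‖ ^ 2 ≤ ∫ x, ‖f (x, y)‖ ^ 2 ∂α := by
      intro i
      filter_upwards [hslice] with y hy
      have h1 : F i y = inner 𝕜 (u i) (hy.toLp _) := by
        rw [L2.inner_def]
        refine integral_congr_ae ?_
        filter_upwards [hy.coeFn_toLp] with x hx
        rw [hx, RCLike.inner_apply]
      have h2 : ‖hy.toLp _‖ ^ 2 = ∫ x, ‖f (x, y)‖ ^ 2 ∂α := by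
        have h3 : inner 𝕜 (hy.toLp _) (hy.toLp _) = ((∫ x, ‖f (x, y)‖ ^ 2 ∂α : ℝ) : 𝕜) := by
          rw [L2.inner_def, ← integral_ofReal]
          refine integral_congr_ae ?_
          filter_upwards [hy.coeFn_toLp] with x hx
          rw [hx, inner_self_eq_norm_sq_to_K, RCLike.ofReal_pow]
        rw [inner_self_eq_norm_sq_to_K] at h3
        exact_mod_cast h3
      rw [h1, ← h2]
      refine pow_le_pow_left₀ (norm_nonneg _) ?_ 2
      have := norm_inner_le_norm (𝕜 := 𝕜) (u i) (hy.toLp _)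
      rwa [u.orthonormal.1 i, one_mul] at this
    have hFmem : ∀ i, MemLp (F i) 2 β := by
      intro i
      have hm : AEStronglyMeasurable (F i) β := by
        have h1 : AEStronglyMeasurable (fun p : X × Y => f p * (starRingEnd 𝕜) (u i p.1))
            (α.prod β) := hfm.1.mul
          (RCLike.continuous_conj.comp_aestronglyMeasurable
            (Lp.aestronglyMeasurable (u i)).comp_fst)
        exact h1.prod_swap.integral_prod_right'
      rw [memLp_two_iff_integrable_sq_norm hm]
      refine hfsq.integral_prod_right.mono' (hm.norm.pow 2) ?_
      filter_upwards [hFbound i] with y hy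
      simpa using hy
    have hF0 : ∀ i, ∀ᵐ y ∂β, F i y = 0 := by
      intro i
      have h0 : (hFmem i).toLp _ = 0 := by
        refine (b i).repr.injective ?_
        rw [map_zero]
        ext j
        rw [(b i).repr_apply_apply, lp.coeFn_zero, Pi.zero_apply]
        have h1 := hfe (i, j)
        have h2 : (fun p => inner 𝕜 (e (i, j) p) (f p)) =ᵐ[α.prod β]
            fun p => f p * (starRingEnd 𝕜) (u i p.1) * (starRingEnd 𝕜) (b i j p.2) := by
          filter_upwards [(hmem (i, j)).coeFn_toLp] with p hp
          rw [hp, RCLike.inner_apply, map_mul, mul_assoc]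
        have h3 : Integrable (fun p => inner 𝕜 (e (i, j) p) (f p)) (α.prod β) :=
          L2.integrable_inner _ _
        rw [L2.inner_def, integral_congr_ae h2, integral_prod_symm _ (h3.congr h2)] at h1
        rw [L2.inner_def, ← h1]
        refine integral_congr_ae ?_
        filter_upwards [(hFmem i).coeFn_toLp] with y hy
        rw [hy, RCLike.inner_apply, ← integral_mul_const]
      filter_upwards [(hFmem i).coeFn_toLp, Lp.eq_zero_iff_ae_eq_zero.1 h0] with y h1 h2
      rw [← h1, h2, Pi.zero_apply]
    -- Countability of ι gives one null set for all i; off it, completeness of u kills the slice.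
    have hsl0 : ∀ᵐ y ∂β, ∫⁻ x, ‖f (x, y)‖ₑ ∂α = 0 := by
      filter_upwards [hslice, ae_all_iff.2 hF0] with y hy h0
      have h1 : hy.toLp _ = 0 := by
        refine u.repr.injective ?_
        rw [map_zero]
        ext i
        rw [u.repr_apply_apply, lp.coeFn_zero, Pi.zero_apply, ← h0 i, L2.inner_def]
        refine integral_congr_ae ?_
        filter_upwards [hy.coeFn_toLp] with x hx
        rw [hx, RCLike.inner_apply]
      rw [lintegral_eq_zero_iff' hy.1.enorm]
      filter_upwards [hy.coeFn_toLp, Lp.eq_zero_iff_ae_eq_zero.1 h1] with x h2 h3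
      rw [← h2, h3]
      simp
    have h0 : ∫⁻ p, ‖f p‖ₑ ∂(α.prod β) = 0 := by
      rw [lintegral_prod_symm _ hfm.1.enorm, lintegral_congr_ae hsl0, lintegral_zero]
    rw [lintegral_eq_zero_iff' hfm.1.enorm] at h0
    refine Lp.eq_zero_iff_ae_eq_zero.2 (h0.mono fun p hp => ?_)
    simpa using hp
  refine ⟨HilbertBasis.mkOfOrthogonalEqBot horth hcomplete, fun i j => ?_⟩
  rw [HilbertBasis.coe_mkOfOrthogonalEqBot]
  exact (hmem (i, j)).coeFn_toLp

end Tensor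

/-! ### Separation of variables. -/

theorem ContinuousLinearMap.derivWithin_comp {F G : Type*} [NormedAddCommGroup F] [NormedSpace ℝ F]
    [NormedAddCommGroup G] [NormedSpace ℝ G] (L : F →L[ℝ] G) {f : ℝ → F} {s : Set ℝ} {x : ℝ}
    (hf : DifferentiableWithinAt ℝ f s x) (hs : UniqueDiffWithinAt ℝ s x) :
    derivWithin (fun t => L (f t)) s x = L (derivWithin f s x) :=
  (L.hasFDerivAt.comp_hasDerivWithinAt x hf.hasDerivWithinAt).derivWithin hs

theorem ContinuousLinearMap.iteratedDerivWithin_two_comp {F G : Type*} [NormedAddCommGroup F]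
    [NormedSpace ℝ F] [NormedAddCommGroup G] [NormedSpace ℝ G] (L : F →L[ℝ] G) {f : ℝ → F}
    {s : Set ℝ} {x : ℝ} (hf : ContDiffOn ℝ 2 f s) (hs : UniqueDiffOn ℝ s) (hx : x ∈ s) :
    iteratedDerivWithin 2 (fun t => L (f t)) s x = L (iteratedDerivWithin 2 f s x) := by
  rw [iteratedDerivWithin_eq_iteratedFDerivWithin, iteratedDerivWithin_eq_iteratedFDerivWithin]
  have := L.iteratedFDerivWithin_comp_left (hf x hx) hs hx (i := 2) le_rfl
  exact congrArg (fun m => m fun _ => (1 : ℝ)) this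

section Separation

variable {𝕜 : Type} [RCLike 𝕜] {H : Type} [NormedAddCommGroup H] [InnerProductSpace 𝕜 H]
  [NormedSpace ℝ H] [IsScalarTower ℝ 𝕜 H]

theorem IsCauchyEigenfunction1D.smul_eigenvector {A : H →ₗ.[𝕜] H} {μ : ℝ} {z : 𝕜} {v : ℝ → 𝕜}
    (hv : IsCauchyEigenfunction1D μ z v) {x : H} (hx0 : x ≠ 0) (hx : x ∈ A.domain)
    (hAx : A ⟨x, hx⟩ = (μ : 𝕜) • x) : IsCauchyEigenfunction A z (fun t => v t • x) := by
  have hud : UniqueDiffOn ℝ (Icc (0 : ℝ) 1) := uniqueDiffOn_Icc zero_lt_one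
  let L : 𝕜 →L[ℝ] H := (ContinuousLinearMap.toSpanSingleton 𝕜 x).restrictScalars ℝ
  have h0 : (0 : ℝ) ∈ Icc (0 : ℝ) 1 := by simp
  refine ⟨L.contDiff.comp_contDiffOn hv.contDiffOn, by simp [hv.initial], ?_, fun t ht => ?_, ?_⟩
  · have := L.derivWithin_comp (hv.contDiffOn.differentiableOn (by norm_num) 0 h0) (hud 0 h0)
    rw [hv.initial_deriv, map_zero] at this
    exact this
  · have h2 : iteratedDerivWithin 2 (fun t => v t • x) (Icc 0 1) t =
        iteratedDerivWithin 2 v (Icc 0 1) t • x :=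
      L.iteratedDerivWithin_two_comp hv.contDiffOn hud (Ioo_subset_Icc_self ht)
    refine ⟨A.domain.smul_mem _ hx, ?_⟩
    have h3 : A ⟨v t • x, A.domain.smul_mem _ hx⟩ = v t • A ⟨x, hx⟩ :=
      A.map_smul (v t) ⟨x, hx⟩
    rw [h2, h3, hAx, smul_smul, smul_smul, ← sub_smul, ← hv.equation t ht, mul_comm (v t)]
  · obtain ⟨t, ht, h⟩ := hv.nonzero
    exact ⟨t, ht, smul_ne_zero h hx0⟩

/-- Pairing with u_k commutes with differentiation in t, and symmetry moves A onto u_k, where it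
acts as μ_k. Completeness provides a k with a nonzero coefficient. -/
theorem IsCauchyEigenfunction.exists_isCauchyEigenfunction1D [CompleteSpace H] {A : H →ₗ.[𝕜] H}
    (hA : IsSelfAdjoint A) {z : 𝕜} {U : ℝ → H} (hU : IsCauchyEigenfunction A z U) {μ : ℕ → ℝ}
    {u : HilbertBasis ℕ 𝕜 H} (hu : IsEigensystem A μ u) :
    ∃ k, IsCauchyEigenfunction1D (μ k) z fun t => inner 𝕜 (u k) (U t) := by
  have hud : UniqueDiffOn ℝ (Icc (0 : ℝ) 1) := uniqueDiffOn_Icc zero_lt_one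
  have h0 : (0 : ℝ) ∈ Icc (0 : ℝ) 1 := by simp
  obtain ⟨t₀, ht₀, hUt₀⟩ := hU.nonzero
  obtain ⟨k, hk⟩ : ∃ k, inner 𝕜 (u k) (U t₀) ≠ 0 := by
    by_contra! h
    refine hUt₀ (u.repr.injective ?_)
    rw [map_zero]
    ext k
    rw [u.repr_apply_apply, lp.coeFn_zero, Pi.zero_apply, h]
  let L : H →L[ℝ] 𝕜 := (innerSL 𝕜 (u k)).restrictScalars ℝ
  refine ⟨k, L.contDiff.comp_contDiffOn hU.contDiffOn, by simp [hU.initial], ?_, fun t ht => ?_,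
    t₀, ht₀, hk⟩
  · have := L.derivWithin_comp (hU.contDiffOn.differentiableOn (by norm_num) 0 h0) (hud 0 h0)
    rw [hU.initial_deriv, map_zero] at this
    exact this
  · have h2 : iteratedDerivWithin 2 (fun t => inner 𝕜 (u k) (U t)) (Icc 0 1) t =
        inner 𝕜 (u k) (iteratedDerivWithin 2 U (Icc 0 1) t) :=
      L.iteratedDerivWithin_two_comp hU.contDiffOn hud (Ioo_subset_Icc_self ht)
    obtain ⟨h3, h4⟩ := hU.equation t ht
    obtain ⟨h5, h6⟩ := hu.eigen k
    have h7 := LinearPMap.inner_apply_eq_of_isSelfAdjoint hA ⟨u k, h5⟩ ⟨U t, h3⟩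
    rw [h6, inner_smul_left, RCLike.conj_ofReal] at h7
    have h8 := congrArg (inner 𝕜 (u k)) h4
    rw [inner_sub_right, inner_smul_right, ← h7] at h8
    rw [h2]
    exact h8

end Separation

/-! ### Asymptotics and the final assembly. -/

/-- Exponential asymptotics from a relative error estimate. -/
theorem isEquivalent_of_abs_sub_one_le {μ l : ℕ → ℝ} (hμ : Tendsto μ atTop atTop)
    (hμ0 : ∀ k, 0 < μ k)
    (h : ∀ k, Real.exp (-(2 * √(μ k))) + 4 * (√(μ k) * Real.exp (-√(μ k))) < 1 →
        |4 * √(μ k) ^ 2 * Real.exp (-√(μ k)) * (l k)⁻¹ - 1| ≤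
          Real.exp (-(2 * √(μ k))) + 2 * (√(μ k) * Real.exp (-√(μ k)))) :
    l ~[atTop] fun k => 4 * μ k * Real.exp (-√(μ k)) := by
  have hs : Tendsto (fun k => √(μ k)) atTop atTop := Real.tendsto_sqrt_atTop.comp hμ
  have h1 : Tendsto (fun a : ℝ => Real.exp (-(2 * a))) atTop (nhds 0) :=
    Real.tendsto_exp_neg_atTop_nhds_zero.comp (tendsto_id.const_mul_atTop two_pos)
  have h2 : Tendsto (fun a : ℝ => a * Real.exp (-a)) atTop (nhds 0) := by
    simpa using Real.tendsto_pow_mul_exp_neg_atTop_nhds_zero 1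
  have h3 : ∀ c : ℝ, Tendsto (fun k => Real.exp (-(2 * √(μ k))) +
      c * (√(μ k) * Real.exp (-√(μ k)))) atTop (nhds 0) := fun c => by
    simpa using (h1.comp hs).add ((h2.comp hs).const_mul c)
  have h4 : Tendsto (fun k => 4 * √(μ k) ^ 2 * Real.exp (-√(μ k)) * (l k)⁻¹) atTop (nhds 1) := by
    rw [tendsto_iff_norm_sub_tendsto_zero]
    refine squeeze_zero' (Eventually.of_forall fun _ => norm_nonneg _) ?_ (h3 2)
    filter_upwards [(h3 4).eventually (gt_mem_nhds one_pos)] with k hk using h k hk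
  refine IsEquivalent.symm ((isEquivalent_iff_tendsto_one ?_).2 ?_)
  · filter_upwards [h4.eventually_ne one_ne_zero] with k hk h0
    rw [h0] at hk
    simp at hk
  · refine h4.congr fun k => ?_
    rw [Real.sq_sqrt (hμ0 k).le, Pi.div_apply, div_eq_mul_inv]

theorem theorem1 {𝕜 : Type} [RCLike 𝕜] {n : ℕ} (hn : 1 ≤ n)
    (Ω : Set (EuclideanSpace ℝ (Fin n)))
    (hΩ_open : IsOpen Ω) (hΩ_conn : IsConnected Ω) (hΩ_bdd : Bornology.IsBounded Ω)
    (A : L2Omega 𝕜 Ω →ₗ.[𝕜] L2Omega 𝕜 Ω)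
    (hA_sa : IsSelfAdjoint A) (hA_cpt : HasCompactResolvent A) (hA_pos : FriedrichsInequality A) :
    (∃ (μ : ℕ → ℝ) (u : HilbertBasis ℕ 𝕜 (L2Omega 𝕜 Ω)), IsEigensystem A μ u) ∧
    ∀ (μ : ℕ → ℝ) (u : HilbertBasis ℕ 𝕜 (L2Omega 𝕜 Ω)), IsEigensystem A μ u →
      ∃ (lam : ℕ → ℕ → ℝ) (v : ℕ → ℕ → ℝ → 𝕜),
        -- the functions `v k m` solve the one-dimensional problems
        (∀ k m, IsCauchyEigenfunction1D (μ k) (lam k m : 𝕜) (v k m)) ∧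
        -- the products `u k (x) * v k m (t)` are eigenfunctions of the problem in the cylinder
        (∀ k m, IsCauchyEigenfunction A (lam k m : 𝕜) (fun t => v k m t • u k)) ∧
        -- they form a complete orthonormal system in `L²(D)`
        (∃ w : HilbertBasis (ℕ × ℕ) 𝕜 (L2Cylinder 𝕜 Ω), ∀ k m,
          (w (k, m) : EuclideanSpace ℝ (Fin n) × ℝ → 𝕜)
            =ᵐ[volume.restrict (Ω ×ˢ Ioo (0 : ℝ) 1)] fun p => u k p.1 * v k m p.2) ∧
        -- there are no other eigenvalues, in the one-dimensional problems or in the cylinder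
        (∀ k, {z : 𝕜 | ∃ y, IsCauchyEigenfunction1D (μ k) z y}
          = range fun m => (lam k m : 𝕜)) ∧
        {z : 𝕜 | ∃ U, IsCauchyEigenfunction A z U}
          = (range fun p : ℕ × ℕ => (lam p.1 p.2 : 𝕜)) ∧
        -- `lam k 0` is the smallest eigenvalue in absolute value, and its asymptotics
        (∀ k m, |lam k 0| ≤ |lam k m|) ∧
        (fun k => lam k 0) ~[atTop] fun k => 4 * μ k * Real.exp (-√(μ k)) := by
  have hinf : Ω.Infinite := by
    have : Nonempty (Fin n) := ⟨⟨0, hn⟩⟩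
    exact infinite_of_mem_nhds _ (hΩ_open.mem_nhds hΩ_conn.nonempty.some_mem)
  have hdim : ¬ FiniteDimensional 𝕜 (L2Omega 𝕜 Ω) :=
    not_finiteDimensional_Lp_restrict 𝕜 volume hΩ_open hinf hΩ_bdd.measure_lt_top.ne
  refine ⟨exists_isEigensystem hA_sa hA_cpt hA_pos hdim, fun μ u hu => ?_⟩
  have hμ0 : ∀ k, 0 < μ k := fun k => one_pos.trans_le (hu.one_le hA_pos k)
  choose lam v b hbv hv hall hmin hasymp using fun k =>
    exists_hilbertBasis_isCauchyEigenfunction1D (𝕜 := 𝕜) (Real.sqrt_pos.2 (hμ0 k))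
  have hsq : ∀ k, √(μ k) ^ 2 = μ k := fun k => Real.sq_sqrt (hμ0 k).le
  simp only [hsq] at hv hall
  have hU : ∀ k m, IsCauchyEigenfunction A (lam k m : 𝕜) (fun t => v k m t • u k) := by
    intro k m
    obtain ⟨h1, h2⟩ := hu.eigen k
    exact (hv k m).smul_eigenvector (u.orthonormal.ne_zero k) h1 h2
  refine ⟨lam, v, hv, hU, ?_, fun k => ?_, ?_, hmin, ?_⟩
  · have hprod : (volume.restrict Ω).prod unitMeasure =
        (volume : Measure (EuclideanSpace ℝ (Fin n) × ℝ)).restrict (Ω ×ˢ Ioo (0 : ℝ) 1) := by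
      rw [Measure.prod_restrict, Measure.volume_eq_prod]
    obtain ⟨w, hw⟩ := exists_hilbertBasis_prod (volume.restrict Ω) unitMeasure u b
    have hw' : ∀ k m, (w (k, m) : EuclideanSpace ℝ (Fin n) × ℝ → 𝕜)
        =ᵐ[(volume.restrict Ω).prod unitMeasure] fun p => u k p.1 * v k m p.2 := by
      intro k m
      filter_upwards [hw k m, Measure.quasiMeasurePreserving_snd.ae (hbv k m)] with p h1 h2
      rw [h1, h2]
    -- The type of w depends on the measure, so w is generalised before the measure is rewritten.
    revert w
    rw [hprod]
    exact fun w _ hw => ⟨w, hw⟩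
  · ext z
    exact ⟨fun ⟨y, hy⟩ => hall k z y hy, fun ⟨m, hm⟩ => ⟨v k m, hm ▸ hv k m⟩⟩
  · ext z
    constructor
    · rintro ⟨U, hU⟩
      obtain ⟨k, hk⟩ := hU.exists_isCauchyEigenfunction1D hA_sa hu
      obtain ⟨m, hm⟩ := hall k z _ hk
      exact ⟨(k, m), hm⟩
    · rintro ⟨⟨k, m⟩, rfl⟩
      exact ⟨_, hU k m⟩
  · exact isEquivalent_of_abs_sub_one_le (hu.tendsto_atTop hA_cpt hA_pos) hμ0 hasymp
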